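/- Let $T$ be an arbitrary (possibly many-sorted) first-order theory in a language $L$; write $|T| := \aleph_0+|L|$, where $|L|$ counts the sorts, the function symbols and the relation symbols of $L$. Let $\kappa>|T|$ be a strong limit cardinal and let $\mathfrak C\models T$ be a monster model with degree of saturation $\kappa$, i.e. a $\kappa$-saturated and strongly $\kappa$-homogeneous model. A cardinal is called *bounded* (and a submodel of such cardinality *small*) if it is less than $\kappa$. Let $S$ be a product of an arbitrary family of sorts (repetitions allowed), let $\bar x$ be the corresponding tuple of variables, and let $X$ be a $\emptyset$-type-definable subset of $S$, that is, a partial type over $\emptyset$ in the variables $\bar x$. Let $S_X(\mathfrak C)$ be the space of complete types over $\mathfrak C$ in the variables $\bar x$ that contain $X$, with its usual topology and the natural action of $\operatorname{Aut}(\mathfrak C)$. Let $EL$ be the Ellis semigroup of the flow $S_X(\mathfrak C)$, that is, the closure of $\{p\mapsto \sigma p : \sigma\in\operatorname{Aut}(\mathfrak C)\}$ in $S_X(\mathfrak C)^{S_X(\mathfrak C)}$ with the topology of pointwise convergence, with composition as the semigroup operation. Let $\operatorname{Autf}_L(\mathfrak C)$ be the subgroup of $\operatorname{Aut}(\mathfrak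 C)$ generated by all automorphisms that fix pointwise some small elementary submodel $M\prec\mathfrak C$, and let $I_L$ be the set of all Lascar invariant types in $S_X(\mathfrak C)$, i.e. of those $p \in S_X(\mathfrak C)$ with $\sigma p=p$ for all $\sigma\in\operatorname{Autf}_L(\mathfrak C)$. **Proposition 5.4.** Let $\mathcal M$ be a minimal left ideal of $EL$. The following conditions are equivalent. (i) $\mathcal M$ is of bounded size, i.e. $|\mathcal M|<\kappa$. (ii) For every $\eta\in\mathcal M$ the image $\operatorname{Im}(\eta)$ is contained in $I_L$. (iii) For some $\eta\in EL$ the image $\operatorname{Im}(\eta)$ is contained in $I_L$. Moreover, if $\mathcal M$ is of bounded size, then $|\mathcal M|\le\beth_3(|T|)=2^{2^{2^{|T|}}}$. -/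

import Mathlib

universe u

namespace ManySorted

/-! ### Many-sorted first-order logic -/

/-- A many-sorted first-order language: a set of sorts, function symbols with finitely many sorted
arguments and a sorted value, and relation symbols with finitely many sorted arguments.
(Constants are function symbols of arity `0`.) -/
structure Language where
  Srt : Type u
  Func : Type u
  arity : Func → ℕ
  dom : (f : Func) → Fin (arity f) → Srt
  cod : Func → Srt
  Rel : Type u
  relArity : Rel → ℕ
  relDom : (R : Rel) → Fin (relArity R) → Srt

namespace Language

/-- The cardinal `|T|` of a theory in the language `L`: the number of `L`-formulas, i.e.
`ℵ₀ + |L|`, where the sorts are counted as part of the language. -/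
noncomputable def card (L : Language.{u}) : Cardinal.{u} :=
  max Cardinal.aleph0 (Cardinal.mk L.Srt + Cardinal.mk L.Func + Cardinal.mk L.Rel)

end Language

variable {L : Language.{u}}

/-- Terms of sort `s` in the variables `V`, where `V s` is the set of variables of sort `s`. -/
inductive Term (L : Language.{u}) (V : L.Srt → Type u) : L.Srt → Type u
  | var {s : L.Srt} (x : V s) : Term L V s
  | app (f : L.Func) (ts : (i : Fin (L.arity f)) → Term L V (L.dom f i)) : Term L V (L.cod f)

/-- The de Bruijn variables of sort `s` in a finite list of sorts: the positions at which the list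
has the entry `s`. -/
inductive BVar {A : Type u} : List A → A → Type u
  | zero {s : A} {Γ : List A} : BVar (s :: Γ) s
  | succ {s t : A} {Γ : List A} (x : BVar Γ s) : BVar (t :: Γ) s

/-- First-order formulas with equality, whose free variables are those of the sorted family `V`
together with finitely many further variables with sorts listed in `Γ`. -/
inductive Formula (L : Language.{u}) (V : L.Srt → Type u) : List L.Srt → Type u
  | falsum {Γ : List L.Srt} : Formula L V Γ
  | eq {Γ : List L.Srt} {s : L.Srt} (t₁ t₂ : Term L (fun r => V r ⊕ BVar Γ r) s) : Formula L V Γ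
  | rel {Γ : List L.Srt} (R : L.Rel)
      (ts : (i : Fin (L.relArity R)) → Term L (fun r => V r ⊕ BVar Γ r) (L.relDom R i)) :
      Formula L V Γ
  | imp {Γ : List L.Srt} (φ ψ : Formula L V Γ) : Formula L V Γ
  | all {Γ : List L.Srt} {s : L.Srt} (φ : Formula L V (s :: Γ)) : Formula L V Γ

/-- Negation. -/
def Formula.not {V : L.Srt → Type u} {Γ : List L.Srt} (φ : Formula L V Γ) : Formula L V Γ :=
  φ.imp .falsum

/-- Sentences: formulas without free variables. -/
abbrev Sentence (L : Language.{u}) : Type u := Formula L (fun _ => PEmpty.{u + 1}) []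

/-- Renaming of variables in a term. -/
def Term.map {V W : L.Srt → Type u} (f : ∀ s, V s → W s) : ∀ {s}, Term L V s → Term L W s
  | _, .var x => .var (f _ x)
  | _, .app g ts => .app g fun i => (ts i).map f

/-- Renaming of the free variables from `V` in a formula (this is also used to replace
parameters by other parameters). -/
def Formula.map {V W : L.Srt → Type u} (f : ∀ s, V s → W s) :
    ∀ {Γ}, Formula L V Γ → Formula L W Γ
  | _, .falsum => .falsum
  | _, .eq t₁ t₂ => .eq (t₁.map fun s => Sum.map (f s) id) (t₂.map fun s => Sum.map (f s) id)
  | _, .rel R ts => .rel R fun i => (ts i).map fun s => Sum.map (f s) id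
  | _, .imp φ ψ => .imp (φ.map f) (ψ.map f)
  | _, .all φ => .all (φ.map f)

/-- An `L`-structure. -/
structure Struct (L : Language.{u}) where
  carrier : L.Srt → Type u
  func : (f : L.Func) → ((i : Fin (L.arity f)) → carrier (L.dom f i)) → carrier (L.cod f)
  rel : (R : L.Rel) → ((i : Fin (L.relArity R)) → carrier (L.relDom R i)) → Prop

/-- The value of a term under an assignment `v` of its variables. -/
def Term.eval (C : Struct L) {V : L.Srt → Type u} (v : ∀ s, V s → C.carrier s) :
    ∀ {s}, Term L V s → C.carrier s
  | _, .var x => v _ x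
  | _, .app f ts => C.func f fun i => (ts i).eval C v

/-- The empty assignment of de Bruijn variables. -/
def emptyEnv {A : Type u} {D : A → Type u} : ∀ s, BVar ([] : List A) s → D s :=
  fun _ x => nomatch x

/-- Extension of an assignment of de Bruijn variables by a value `a` of the new first variable. -/
def consEnv {A : Type u} {D : A → Type u} {Γ : List A} {t : A} (a : D t)
    (e : ∀ s, BVar Γ s → D s) : ∀ s, BVar (t :: Γ) s → D s
  | _, .zero => a
  | _, .succ x => e _ x

/-- Truth of a formula in a structure, under an assignment `v` of the variables from `V` and an
assignment `e` of the de Bruijn variables. -/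
def Formula.Realize (C : Struct L) {V : L.Srt → Type u} (v : ∀ s, V s → C.carrier s) :
    ∀ {Γ}, Formula L V Γ → (∀ s, BVar Γ s → C.carrier s) → Prop
  | _, .falsum, _ => False
  | _, .eq t₁ t₂, e =>
      t₁.eval C (fun s => Sum.elim (v s) (e s)) = t₂.eval C (fun s => Sum.elim (v s) (e s))
  | _, .rel R ts, e => C.rel R fun i => (ts i).eval C fun s => Sum.elim (v s) (e s)
  | _, .imp φ ψ, e => φ.Realize C v e → ψ.Realize C v e
  | _, .all (s := s) φ, e => ∀ a : C.carrier s, φ.Realize C v (consEnv a e)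

/-- Truth of a formula all of whose free variables are from `V`. -/
def Formula.Holds (C : Struct L) {V : L.Srt → Type u} (φ : Formula L V [])
    (v : ∀ s, V s → C.carrier s) : Prop :=
  φ.Realize C v emptyEnv

/-- `C` is a model of the theory `T`. -/
def Struct.IsModel (C : Struct L) (T : Set (Sentence L)) : Prop :=
  ∀ φ ∈ T, φ.Holds C fun _ => PEmpty.elim

/-! ### Elementary submodels and automorphisms -/

/-- A substructure: a sorted subset closed under the functions. -/
structure Substr (C : Struct L) where
  carrier : ∀ s, Set (C.carrier s)
  func_mem : ∀ (f : L.Func) (a : (i : Fin (L.arity f)) → C.carrier (L.dom f i)),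
    (∀ i, a i ∈ carrier (L.dom f i)) → C.func f a ∈ carrier (L.cod f)

/-- The induced structure on a substructure. -/
def Substr.toStruct {C : Struct L} (M : Substr C) : Struct L where
  carrier s := M.carrier s
  func f a := ⟨C.func f fun i => a i, M.func_mem f _ fun i => (a i).2⟩
  rel R a := C.rel R fun i => a i

/-- `M ≺ C`: every formula with parameters from `M` has the same truth value in `M` and in `C`. -/
def Substr.IsElementary {C : Struct L} (M : Substr C) : Prop :=
  ∀ φ : Formula L (fun s => M.carrier s) [],
    φ.Holds M.toStruct (fun _ a => a) ↔ φ.Holds C (fun _ a => a.1)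

/-- The total cardinality of a sorted subset of `C`. -/
def size {C : Struct L} (A : ∀ s, Set (C.carrier s)) : Cardinal.{u} :=
  Cardinal.mk (Σ s, A s)

/-- The automorphism group of `C`. -/
def Aut (C : Struct L) : Subgroup (∀ s, Equiv.Perm (C.carrier s)) where
  carrier := {σ |
    (∀ (f : L.Func) (a : (i : Fin (L.arity f)) → C.carrier (L.dom f i)),
      σ _ (C.func f a) = C.func f fun i => σ _ (a i)) ∧
    ∀ (R : L.Rel) (a : (i : Fin (L.relArity R)) → C.carrier (L.relDom R i)),
      C.rel R (fun i => σ _ (a i)) ↔ C.rel R a}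
  mul_mem' := by
    rintro σ τ ⟨h₁, h₂⟩ ⟨h₃, h₄⟩
    refine ⟨fun f a => ?_, fun R a => ?_⟩
    · simp [h₁, h₃]
    · simpa using (h₂ R fun i => τ _ (a i)).trans (h₄ R a)
  one_mem' := by simp
  inv_mem' := by
    rintro σ ⟨h₁, h₂⟩
    refine ⟨fun f a => ?_, fun R a => ?_⟩
    · apply (σ _).injective
      simp [h₁]
    · have h := h₂ R fun i => (σ (L.relDom R i))⁻¹ (a i)
      simpa using h.symm

/-- The group `Autf_L(C)` of Lascar strong automorphisms: the subgroup generated by the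
automorphisms that fix pointwise some elementary submodel of size less than `κ`. -/
def AutfL (C : Struct L) (κ : Cardinal.{u}) : Subgroup (Aut C) :=
  Subgroup.closure {σ | ∃ M : Substr C, M.IsElementary ∧ size M.carrier < κ ∧
    ∀ s, ∀ a ∈ M.carrier s, σ.1 s a = a}

/-! ### Monster models -/

/-- `κ`-saturation: every set of formulas in one variable (of any sort `s`) over a set of fewer than
`κ` parameters which is finitely satisfiable in `C` is realized in `C`. -/
def IsSaturated (C : Struct L) (κ : Cardinal.{u}) : Prop :=
  ∀ A : ∀ s, Set (C.carrier s), size A < κ →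
    ∀ (s : L.Srt) (p : Set (Formula L (fun t => A t) [s])),
      (∀ F : Finset (Formula L (fun t => A t) [s]), ↑F ⊆ p →
        ∃ b : C.carrier s, ∀ φ ∈ F, φ.Realize C (fun _ a => a.1) (consEnv b emptyEnv)) →
      ∃ b : C.carrier s, ∀ φ ∈ p, φ.Realize C (fun _ a => a.1) (consEnv b emptyEnv)

/-- Strong `κ`-homogeneity: every elementary map from a set of fewer than `κ` elements of `C` to `C`
extends to an automorphism of `C`. -/
def IsStronglyHomogeneous (C : Struct L) (κ : Cardinal.{u}) : Prop :=
  ∀ A : ∀ s, Set (C.carrier s), size A < κ →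
    ∀ f : ∀ s, A s → C.carrier s,
      (∀ φ : Formula L (fun s => A s) [], φ.Holds C (fun _ a => a.1) ↔ φ.Holds C f) →
      ∃ σ ∈ Aut C, ∀ s, ∀ a : A s, σ s a = f s a

/-- `C` is a monster model (of its theory, or of any theory in the language `L` which it satisfies)
with degree of saturation `κ`: it is `κ`-saturated and strongly `κ`-homogeneous, and `κ` is a strong
limit cardinal which is bigger than `|T|`. -/
structure IsMonster (C : Struct L) (κ : Cardinal.{u}) : Prop where
  strongLimit : κ.IsStrongLimit
  card_lt : L.card < κ
  saturated : IsSaturated C κ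
  homogeneous : IsStronglyHomogeneous C κ

/-! ### Global types -/

theorem Term.eval_map (C : Struct L) {V W : L.Srt → Type u} (f : ∀ s, V s → W s)
    (w : ∀ s, W s → C.carrier s) {s : L.Srt} (t : Term L V s) :
    (t.map f).eval C w = t.eval C fun s x => w s (f s x) := by
  induction t with
  | var x => rfl
  | app g ts ih => simp [Term.map, Term.eval, ih]

theorem Term.map_map {V W U : L.Srt → Type u} (f : ∀ s, V s → W s) (g : ∀ s, W s → U s)
    {s : L.Srt} (t : Term L V s) : (t.map f).map g = t.map fun s x => g s (f s x) := by
  induction t with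
  | var x => rfl
  | app h ts ih => simp [Term.map, ih]

theorem Term.map_id {V : L.Srt → Type u} {s : L.Srt} (t : Term L V s) :
    t.map (fun _ x => x) = t := by
  induction t with
  | var x => rfl
  | app h ts ih => simp [Term.map, ih]

theorem Formula.realize_map (C : Struct L) {V W : L.Srt → Type u} (f : ∀ s, V s → W s)
    (w : ∀ s, W s → C.carrier s) {Γ : List L.Srt} (φ : Formula L V Γ)
    (e : ∀ s, BVar Γ s → C.carrier s) :
    (φ.map f).Realize C w e ↔ φ.Realize C (fun s x => w s (f s x)) e := by
  have key : ∀ {Γ : List L.Srt} (e : ∀ s, BVar Γ s → C.carrier s),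
      (fun (s : L.Srt) (x : V s ⊕ BVar Γ s) => Sum.elim (w s) (e s) (Sum.map (f s) id x)) =
        fun s => Sum.elim (fun x => w s (f s x)) (e s) := by
    intro Γ e
    funext s x
    cases x <;> rfl
  induction φ with
  | falsum => rfl
  | eq t₁ t₂ => simp only [Formula.map, Formula.Realize, Term.eval_map, key]
  | rel R ts => simp only [Formula.map, Formula.Realize, Term.eval_map, key]
  | imp φ ψ ih₁ ih₂ => simp only [Formula.map, Formula.Realize, ih₁, ih₂]
  | all φ ih => simp only [Formula.map, Formula.Realize, ih]

theorem Formula.map_map {V W U : L.Srt → Type u} (f : ∀ s, V s → W s) (g : ∀ s, W s → U s)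
    {Γ : List L.Srt} (φ : Formula L V Γ) : (φ.map f).map g = φ.map fun s x => g s (f s x) := by
  have key : ∀ {Γ : List L.Srt},
      (fun (s : L.Srt) (x : V s ⊕ BVar Γ s) => Sum.map (g s) id (Sum.map (f s) id x)) =
        fun s => Sum.map (fun x => g s (f s x)) id := by
    intro Γ
    funext s x
    cases x <;> rfl
  induction φ with
  | falsum => rfl
  | eq t₁ t₂ => simp only [Formula.map, Term.map_map, key]
  | rel R ts => simp only [Formula.map, Term.map_map, key]
  | imp φ ψ ih₁ ih₂ => simp only [Formula.map, ih₁, ih₂]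
  | all φ ih => simp only [Formula.map, ih]

theorem Formula.map_id {V : L.Srt → Type u} {Γ : List L.Srt} (φ : Formula L V Γ) :
    φ.map (fun _ x => x) = φ := by
  have key : ∀ {Γ : List L.Srt},
      (fun (s : L.Srt) => Sum.map (fun x : V s => x) (id : BVar Γ s → BVar Γ s)) =
        fun _ x => x := by
    intro Γ
    funext s x
    cases x <;> rfl
  induction φ with
  | falsum => rfl
  | eq t₁ t₂ => simp only [Formula.map, key, Term.map_id]
  | rel R ts => simp only [Formula.map, key, Term.map_id]
  | imp φ ψ ih₁ ih₂ => simp only [Formula.map, ih₁, ih₂]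
  | all φ ih => simp only [Formula.map, ih]

/-- Formulas in the variables `I` with parameters from `C`. -/
abbrev GlobalFormula (C : Struct L) (I : L.Srt → Type u) : Type u :=
  Formula L (fun s => I s ⊕ C.carrier s) []

/-- `C ⊨ φ(a)`, for a tuple `a` from the product of sorts that corresponds to the variables. -/
def GlobalFormula.HoldsAt {C : Struct L} {I : L.Srt → Type u} (φ : GlobalFormula C I)
    (a : ∀ s, I s → C.carrier s) : Prop :=
  Formula.Holds C φ fun s => Sum.elim (a s) id

/-- The formula obtained by applying `σ` to the parameters of `φ`. -/
def GlobalFormula.applyAut {C : Struct L} {I : L.Srt → Type u} (σ : Aut C)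
    (φ : GlobalFormula C I) : GlobalFormula C I :=
  Formula.map (fun s => Sum.map id (σ.1 s)) φ

/-- A complete type over `C` in the variables `I`, i.e. an element of `S_S(C)`, where `S` is the
product of sorts which has, for each sort `s`, one factor of sort `s` for each element of `I s`. -/
@[ext]
structure GlobalType (C : Struct L) (I : L.Srt → Type u) where
  formulas : Set (GlobalFormula C I)
  finSat : ∀ F : Finset (GlobalFormula C I), ↑F ⊆ formulas →
    ∃ a : ∀ s, I s → C.carrier s, ∀ φ ∈ F, φ.HoldsAt a
  complete : ∀ φ : GlobalFormula C I, φ ∈ formulas ∨ φ.not ∈ formulas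

/-- An automorphism preserves the truth of all formulas. -/
theorem Term.eval_aut {C : Struct L} (σ : Aut C) {V : L.Srt → Type u}
    (v : ∀ s, V s → C.carrier s) {s : L.Srt} (t : Term L V s) :
    t.eval C (fun s x => σ.1 s (v s x)) = σ.1 s (t.eval C v) := by
  induction t with
  | var x => rfl
  | app g ts ih => simp [Term.eval, ih, σ.2.1]

theorem Formula.realize_aut {C : Struct L} (σ : Aut C) {V : L.Srt → Type u}
    (v : ∀ s, V s → C.carrier s) {Γ : List L.Srt} (φ : Formula L V Γ)
    (e : ∀ s, BVar Γ s → C.carrier s) :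
    φ.Realize C (fun s x => σ.1 s (v s x)) (fun s x => σ.1 s (e s x)) ↔ φ.Realize C v e := by
  have key : ∀ {Γ : List L.Srt} (e : ∀ s, BVar Γ s → C.carrier s),
      (fun (s : L.Srt) => Sum.elim (fun x => σ.1 s (v s x)) (fun x => σ.1 s (e s x))) =
        fun s x => σ.1 s (Sum.elim (v s) (e s) x) := by
    intro Γ e
    funext s x
    cases x <;> rfl
  induction φ with
  | falsum => rfl
  | eq t₁ t₂ => simp only [Formula.Realize, key, Term.eval_aut, EmbeddingLike.apply_eq_iff_eq]
  | rel R ts => simp only [Formula.Realize, key, Term.eval_aut, σ.2.2]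
  | imp φ ψ ih₁ ih₂ => simp only [Formula.Realize, ih₁, ih₂]
  | @all Γ t φ ih =>
    simp only [Formula.Realize]
    rw [(σ.1 t).surjective.forall]
    refine forall_congr' fun a => ?_
    refine Iff.trans ?_ (ih (consEnv a e))
    have h : consEnv (σ.1 t a) (fun s x => σ.1 s (e s x)) =
        fun s x => σ.1 s (consEnv (D := C.carrier) a e s x) := by
      funext s x
      cases x <;> rfl
    rw [h]

theorem GlobalFormula.holdsAt_applyAut {C : Struct L} {I : L.Srt → Type u} (σ : Aut C)
    (φ : GlobalFormula C I) (a : ∀ s, I s → C.carrier s) :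
    (φ.applyAut σ).HoldsAt (fun s x => σ.1 s (a s x)) ↔ φ.HoldsAt a := by
  unfold HoldsAt applyAut Formula.Holds
  rw [Formula.realize_map, ← Formula.realize_aut σ (fun s => Sum.elim (a s) id) φ]
  have h : (fun (s : L.Srt) (x : I s ⊕ C.carrier s) =>
      Sum.elim (fun x => σ.1 s (a s x)) id (Sum.map id (σ.1 s) x)) =
      fun s x => σ.1 s (Sum.elim (a s) id x) := by
    funext s x
    cases x <;> rfl
  have h' : (emptyEnv : ∀ s, BVar [] s → C.carrier s) = fun s x => σ.1 s (emptyEnv s x) := by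
    funext s x
    cases x
  rw [h, ← h']

theorem GlobalFormula.applyAut_one {C : Struct L} {I : L.Srt → Type u} (φ : GlobalFormula C I) :
    φ.applyAut 1 = φ := by
  conv_rhs => rw [← Formula.map_id φ]
  unfold applyAut
  congr 1
  funext s x
  cases x <;> rfl

theorem GlobalFormula.applyAut_applyAut {C : Struct L} {I : L.Srt → Type u} (σ τ : Aut C)
    (φ : GlobalFormula C I) : (φ.applyAut τ).applyAut σ = φ.applyAut (σ * τ) := by
  unfold applyAut
  rw [Formula.map_map]
  congr 1
  funext s x
  cases x <;> rfl

/-- The action of `Aut(C)` on global types: `φ(x, a) ∈ σ p` if and only if `φ(x, σ⁻¹ a) ∈ p`. -/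
instance (C : Struct L) (I : L.Srt → Type u) : MulAction (Aut C) (GlobalType C I) where
  smul σ p :=
    { formulas := {φ | φ.applyAut σ⁻¹ ∈ p.formulas}
      finSat := by
        classical
        intro F hF
        obtain ⟨a, ha⟩ := p.finSat (F.image fun φ => φ.applyAut σ⁻¹) (by
          intro ψ hψ
          obtain ⟨φ, hφ, rfl⟩ := Finset.mem_image.1 (Finset.mem_coe.1 hψ)
          exact hF hφ)
        refine ⟨fun s x => σ.1 s (a s x), fun φ hφ => ?_⟩
        have h := ha _ (Finset.mem_image_of_mem _ hφ)
        rw [← GlobalFormula.holdsAt_applyAut σ, GlobalFormula.applyAut_applyAut, mul_inv_cancel,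
          GlobalFormula.applyAut_one] at h
        exact h
      complete := fun φ => p.complete (φ.applyAut σ⁻¹) }
  one_smul p := by
    ext φ
    change GlobalFormula.applyAut 1⁻¹ φ ∈ p.formulas ↔ _
    rw [inv_one, GlobalFormula.applyAut_one]
  mul_smul σ τ p := by
    ext φ
    change GlobalFormula.applyAut (σ * τ)⁻¹ φ ∈ p.formulas ↔
      GlobalFormula.applyAut τ⁻¹ (GlobalFormula.applyAut σ⁻¹ φ) ∈ p.formulas
    rw [GlobalFormula.applyAut_applyAut, mul_inv_rev]

/-- The space `S_X(C)` of complete types over `C` concentrated on `X`, for a partial type `X` over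
`∅` in the variables `I`. -/
def TypeSpace (C : Struct L) {I : L.Srt → Type u} (X : Set (Formula L I [])) : Type u :=
  {p : GlobalType C I // ∀ φ ∈ X, φ.map (fun _ => Sum.inl) ∈ p.formulas}

namespace TypeSpace

variable {C : Struct L} {I : L.Srt → Type u} {X : Set (Formula L I [])}

/-- The usual topology, with the sets `[φ] = {p | φ ∈ p}` as a basis. -/
instance : TopologicalSpace (TypeSpace C X) :=
  TopologicalSpace.generateFrom
    {U | ∃ φ : GlobalFormula C I, U = {p : TypeSpace C X | φ ∈ p.1.formulas}}

/-- The action of `Aut(C)` on `S_X(C)`. -/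
instance : MulAction (Aut C) (TypeSpace C X) where
  smul σ p := ⟨σ • p.1, fun φ hφ => by
    change GlobalFormula.applyAut σ⁻¹ (φ.map fun _ => Sum.inl) ∈ p.1.formulas
    unfold GlobalFormula.applyAut
    rw [Formula.map_map]
    exact p.2 φ hφ⟩
  one_smul p := Subtype.ext (one_smul _ p.1)
  mul_smul σ τ p := Subtype.ext (mul_smul σ τ p.1)

/-- The set `I_L` of Lascar invariant types in `S_X(C)`. -/
def lascarInvariant (X : Set (Formula L I [])) (κ : Cardinal.{u}) : Set (TypeSpace C X) :=
  {p | ∀ σ ∈ AutfL C κ, σ • p = p}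

end TypeSpace

/-! ### Ellis semigroups -/

/-- The (underlying set of the) Ellis semigroup of a flow `(G, Y)`: the closure, in the topology of
pointwise convergence on the set of all functions `Y → Y`, of the set of the functions
`y ↦ g • y`. The semigroup operation is composition. -/
def ellisSemigroup (G Y : Type*) [SMul G Y] [TopologicalSpace Y] : Set (Y → Y) :=
  closure (Set.range fun (g : G) (y : Y) => g • y)

/-- `J` is a (nonempty) left ideal of the semigroup `E` of functions. -/
def IsLeftIdeal {Y : Type*} (E J : Set (Y → Y)) : Prop :=
  J ⊆ E ∧ J.Nonempty ∧ ∀ f ∈ E, ∀ g ∈ J, f ∘ g ∈ J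

/-- `J` is a minimal left ideal of the semigroup `E` of functions. -/
def IsMinimalLeftIdeal {Y : Type*} (E J : Set (Y → Y)) : Prop :=
  IsLeftIdeal E J ∧ ∀ K, IsLeftIdeal E K → K ⊆ J → K = J

end ManySorted

namespace ManySorted

/-! ### Assignments -/

section Env

variable {A : Type u} {D : A → Type u}

/-! The implication from (i) to (ii) rests on `IsMonster.eq_of_bounded_invariant`: a bounded
invariant equivalence relation on finite tuples does not separate tuples with the same type over a
small `N ≺ C`. Fix `p` and a formula `ψ(x, y)`, and send a tuple `a` to the set of `f ∈ M` with
`ψ(x, a) ∈ f p`. There are at most `2 ^ |M| < κ` values, and the induced equivalence is invariant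
because `M` is stable under left composition with automorphisms. If `ρ` fixes `N`, then `a` and `ρ⁻¹
a` have the same type over `N`, hence the same value, and so `ρ` fixes every `f p`.

For the converse and the bound, fix `μ ∈ M`. By minimality every element of `M` is `θ ∘ μ` with `θ`
in the Ellis semigroup, so when `μ` has values in `I_L` only the restriction of `θ` to `I_L`
matters. Take `N ≺ C` of size at most `|T|`. On `I_L` an automorphism `σ` acts through the type of
`σ N` over `N` (`smul_eq_smul_of_holds_iff`), and a limit of automorphisms is determined there by a
family of sets of such types. A type is a set of at most `|T|` formulas, which gives three
exponentials (`exists_code_ellisSemigroup`); they stay below the strong limit `κ`.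

For (iii) implies (ii), `I_L` is stable under the Ellis semigroup, and by minimality each `η ∈ M`
factors as `θ ∘ ν ∘ η` for the given `ν`. -/

theorem env_nil_eq (e : ∀ s, BVar ([] : List A) s → D s) : e = emptyEnv := by
  funext s x
  cases x

theorem consEnv_eta {Γ : List A} {t : A} (e : ∀ s, BVar (t :: Γ) s → D s) :
    consEnv (e t .zero) (fun s x => e s x.succ) = e := by
  funext s x
  cases x <;> rfl

/-- The position of a de Bruijn variable. -/
def BVar.index : ∀ {Γ : List A} {s : A}, BVar Γ s → ℕ
  | _, _, .zero => 0
  | _, _, .succ x => x.index + 1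

theorem BVar.index_injective : ∀ {Γ : List A} {s t : A} (x : BVar Γ s) (y : BVar Γ t),
    x.index = y.index → (⟨s, x⟩ : Σ r, BVar Γ r) = ⟨t, y⟩
  | _, _, _, .zero, .zero, _ => rfl
  | _, _, _, .zero, .succ _, h => by simp [BVar.index] at h
  | _, _, _, .succ _, .zero, h => by simp [BVar.index] at h
  | _, _, _, .succ x, .succ y, h => by
    have := BVar.index_injective x y (by simpa [BVar.index] using h)
    cases this
    rfl

theorem BVar.index_lt : ∀ {Γ : List A} {s : A} (x : BVar Γ s), x.index < Γ.length
  | _, _, .zero => by simp [BVar.index]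
  | _, _, .succ x => by simpa [BVar.index] using x.index_lt

instance (Γ : List A) : Finite (Σ s, BVar Γ s) :=
  Finite.of_injective (fun x => (⟨x.2.index, x.2.index_lt⟩ : Fin Γ.length)) fun x y h =>
    BVar.index_injective x.2 y.2 (congrArg Fin.val h)

/-- A finite set of sorted elements is covered by an assignment of de Bruijn variables. -/
theorem exists_env_covering (S : Set (Σ s, D s)) (hS : S.Finite) :
    ∃ (Γ : List A) (a : ∀ s, BVar Γ s → D s), ∀ x ∈ S, ∃ y, a x.1 y = x.2 := by
  induction S, hS using Set.Finite.induction_on with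
  | empty => exact ⟨[], emptyEnv, by simp⟩
  | @insert x S _ _ ih =>
    obtain ⟨Γ, a, h⟩ := ih
    refine ⟨x.1 :: Γ, consEnv x.2 a, ?_⟩
    rintro y (rfl | hy)
    · exact ⟨.zero, rfl⟩
    · obtain ⟨z, hz⟩ := h y hy
      exact ⟨z.succ, hz⟩

end Env

variable {L : Language.{u}}

/-! ### Connectives and renaming -/

namespace Formula

variable {V W : L.Srt → Type u}

/-- Existential quantification over the first de Bruijn variable. -/
def ex {Γ : List L.Srt} {s : L.Srt} (φ : Formula L V (s :: Γ)) : Formula L V Γ :=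
  φ.not.all.not

/-- Conjunction of a list of formulas. -/
def conj {Γ : List L.Srt} : List (Formula L V Γ) → Formula L V Γ
  | [] => falsum.not
  | φ :: l => (φ.imp (conj l).not).not

/-- Existential quantification over all de Bruijn variables. -/
def exs : ∀ {Γ : List L.Srt}, Formula L V Γ → Formula L V []
  | [], φ => φ
  | _ :: _, φ => φ.ex.exs

variable {C : Struct L} {v : ∀ s, V s → C.carrier s}

theorem realize_not {Γ : List L.Srt} (φ : Formula L V Γ) (e : ∀ s, BVar Γ s → C.carrier s) :
    φ.not.Realize C v e ↔ ¬ φ.Realize C v e := Iff.rfl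

theorem realize_ex {Γ : List L.Srt} {s : L.Srt} (φ : Formula L V (s :: Γ))
    (e : ∀ s, BVar Γ s → C.carrier s) :
    φ.ex.Realize C v e ↔ ∃ b, φ.Realize C v (consEnv b e) := by
  change ¬ (∀ b, ¬ _) ↔ _
  push Not
  rfl

theorem realize_conj {Γ : List L.Srt} (l : List (Formula L V Γ))
    (e : ∀ s, BVar Γ s → C.carrier s) :
    (conj l).Realize C v e ↔ ∀ φ ∈ l, φ.Realize C v e := by
  induction l with
  | nil => simp [conj, realize_not, Realize]
  | cons φ l ih =>
    simp only [conj, realize_not, Realize, ih, List.forall_mem_cons]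
    tauto

theorem realize_exs : ∀ {Γ : List L.Srt} (φ : Formula L V Γ),
    φ.exs.Realize C v emptyEnv ↔ ∃ e, φ.Realize C v e
  | [], φ => ⟨fun h => ⟨_, h⟩, fun ⟨e, h⟩ => by rwa [env_nil_eq e] at h⟩
  | t :: Γ, φ => by
    simp only [exs, realize_exs, realize_ex]
    exact ⟨fun ⟨_, _, h⟩ => ⟨_, h⟩, fun ⟨e, h⟩ => ⟨_, _, (consEnv_eta e).symm ▸ h⟩⟩

/-- Extension of a renaming of variables to one more de Bruijn variable. -/
def liftVar {Γ Δ : List L.Srt} (ρ : ∀ s, V s ⊕ BVar Γ s → W s ⊕ BVar Δ s) (t : L.Srt) :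
    ∀ s, V s ⊕ BVar (t :: Γ) s → W s ⊕ BVar (t :: Δ) s
  | s, .inl x => Sum.map id .succ (ρ s (.inl x))
  | _, .inr .zero => .inr .zero
  | s, .inr (.succ x) => Sum.map id .succ (ρ s (.inr x))

/-- Renaming of all variables, including the de Bruijn variables. -/
def rename : ∀ {Γ Δ : List L.Srt}, (∀ s, V s ⊕ BVar Γ s → W s ⊕ BVar Δ s) → Formula L V Γ →
    Formula L W Δ
  | _, _, _, .falsum => .falsum
  | _, _, ρ, .eq t₁ t₂ => .eq (t₁.map ρ) (t₂.map ρ)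
  | _, _, ρ, .rel R ts => .rel R fun i => (ts i).map ρ
  | _, _, ρ, .imp φ ψ => .imp (φ.rename ρ) (ψ.rename ρ)
  | _, _, ρ, .all (s := t) φ => .all (φ.rename (liftVar ρ t))

/-- The renaming and all assignments are generalized because a quantifier replaces `ρ` by its lift.
-/
theorem realize_rename {Γ : List L.Srt} (φ : Formula L V Γ) : ∀ {Δ : List L.Srt}
    (ρ : ∀ s, V s ⊕ BVar Γ s → W s ⊕ BVar Δ s) (w : ∀ s, W s → C.carrier s)
    (e : ∀ s, BVar Δ s → C.carrier s) (v : ∀ s, V s → C.carrier s)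
    (e' : ∀ s, BVar Γ s → C.carrier s),
    (∀ s x, Sum.elim (w s) (e s) (ρ s x) = Sum.elim (v s) (e' s) x) →
    ((φ.rename ρ).Realize C w e ↔ φ.Realize C v e') := by
  induction φ with
  | falsum => intros; rfl
  | eq t₁ t₂ =>
    intro Δ ρ w e v e' h
    simp only [rename, Realize, Term.eval_map, h]
  | rel R ts =>
    intro Δ ρ w e v e' h
    simp only [rename, Realize, Term.eval_map, h]
  | imp φ ψ ih₁ ih₂ =>
    intro Δ ρ w e v e' h
    simp only [rename, Realize, ih₁ ρ w e v e' h, ih₂ ρ w e v e' h]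
  | all φ ih =>
    intro Δ ρ w e v e' h
    refine forall_congr' fun b => ih _ w _ v _ ?_
    intro s x
    rcases x with x | x
    · rw [Sum.elim_inl, ← Sum.elim_inl (v s) (e' s) x, ← h]
      change Sum.elim _ _ (Sum.map id BVar.succ (ρ s (Sum.inl x))) = _
      cases ρ s (Sum.inl x) <;> rfl
    · cases x with
      | zero => rfl
      | succ x =>
        change _ = Sum.elim (v s) (e' s) (Sum.inr x)
        rw [← h]
        change Sum.elim _ _ (Sum.map id BVar.succ (ρ s (Sum.inr x))) = _
        cases ρ s (Sum.inr x) <;> rfl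

/-- The de Bruijn variables of a formula turned into free variables. -/
def unbind {Γ : List L.Srt} (φ : Formula L V Γ) : Formula L (fun s => V s ⊕ BVar Γ s) [] :=
  φ.rename fun _ => Sum.inl

theorem holds_unbind {Γ : List L.Srt} (φ : Formula L V Γ) (e : ∀ s, BVar Γ s → C.carrier s) :
    φ.unbind.Holds C (fun s => Sum.elim (v s) (e s)) ↔ φ.Realize C v e :=
  realize_rename _ _ _ _ _ _ fun _ _ => rfl

/-- Free variables of a formula turned into de Bruijn variables. -/
def bind {Γ : List L.Srt} (φ : Formula L (fun s => V s ⊕ BVar Γ s) []) : Formula L V Γ :=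
  φ.rename fun s => Sum.elim id fun x => emptyEnv (D := fun s => V s ⊕ BVar Γ s) s x

theorem realize_bind {Γ : List L.Srt} (φ : Formula L (fun s => V s ⊕ BVar Γ s) [])
    (e : ∀ s, BVar Γ s → C.carrier s) :
    φ.bind.Realize C v e ↔ φ.Holds C (fun s => Sum.elim (v s) (e s)) := by
  refine realize_rename _ _ _ _ _ _ fun s x => ?_
  rcases x with x | x
  · rfl
  · cases x

/-- All de Bruijn variables but the first one turned into free variables. -/
def unbindTail {Γ : List L.Srt} {t : L.Srt} (φ : Formula L V (t :: Γ)) :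
    Formula L (fun s => V s ⊕ BVar Γ s) [t] :=
  φ.rename fun
    | _, .inl x => .inl (.inl x)
    | _, .inr .zero => .inr .zero
    | _, .inr (.succ x) => .inl (.inr x)

theorem realize_unbindTail {Γ : List L.Srt} {t : L.Srt} (φ : Formula L V (t :: Γ))
    (b : C.carrier t) (e : ∀ s, BVar Γ s → C.carrier s) :
    φ.unbindTail.Realize C (fun s => Sum.elim (v s) (e s)) (consEnv b emptyEnv) ↔
      φ.Realize C v (consEnv b e) := by
  refine realize_rename _ _ _ _ _ _ fun s x => ?_
  rcases x with x | x
  · rfl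
  · cases x <;> rfl

end Formula

/-! ### Finite supports -/

/-- Allowing every `S'` that contains the support, and not only the support itself, lets the
supports of subexpressions be united without further renaming. `U` holds the de Bruijn variables,
which stay untouched. -/
theorem Term.exists_finite_support {V W U : L.Srt → Type u} {s : L.Srt}
    (t : Term L (fun s => (V s ⊕ W s) ⊕ U s) s) :
    ∃ S : Set (Σ s, W s), S.Finite ∧ ∀ S' : ∀ s, Set (W s), (∀ x ∈ S, x.2 ∈ S' x.1) →
      ∃ t' : Term L (fun s => (V s ⊕ S' s) ⊕ U s) s,
        t'.map (fun _ => Sum.map (Sum.map id Subtype.val) id) = t := by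
  induction t with
  | @var r x =>
    rcases x with (x | x) | x
    · exact ⟨∅, Set.finite_empty, fun S' _ => ⟨.var (.inl (.inl x)), rfl⟩⟩
    · exact ⟨{⟨r, x⟩}, Set.finite_singleton _, fun S' h =>
        ⟨.var (.inl (.inr ⟨x, h _ rfl⟩)), rfl⟩⟩
    · exact ⟨∅, Set.finite_empty, fun S' _ => ⟨.var (.inr x), rfl⟩⟩
  | app f ts ih =>
    choose S hS h using ih
    refine ⟨⋃ i, S i, Set.finite_iUnion hS, fun S' hS' => ?_⟩
    choose t' ht' using fun i => h i S' fun x hx => hS' x (Set.mem_iUnion_of_mem i hx)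
    exact ⟨.app f t', by simp only [Term.map, ht']⟩

theorem Formula.exists_finite_support {V W : L.Srt → Type u} {Γ : List L.Srt}
    (φ : Formula L (fun s => V s ⊕ W s) Γ) :
    ∃ S : Set (Σ s, W s), S.Finite ∧ ∀ S' : ∀ s, Set (W s), (∀ x ∈ S, x.2 ∈ S' x.1) →
      ∃ φ' : Formula L (fun s => V s ⊕ S' s) Γ, φ'.map (fun _ => Sum.map id Subtype.val) = φ := by
  induction φ with
  | falsum => exact ⟨∅, Set.finite_empty, fun _ _ => ⟨.falsum, rfl⟩⟩
  | eq t₁ t₂ =>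
    obtain ⟨S₁, hS₁, h₁⟩ := t₁.exists_finite_support
    obtain ⟨S₂, hS₂, h₂⟩ := t₂.exists_finite_support
    refine ⟨S₁ ∪ S₂, hS₁.union hS₂, fun S' hS' => ?_⟩
    obtain ⟨t₁', ht₁⟩ := h₁ S' fun x hx => hS' x (.inl hx)
    obtain ⟨t₂', ht₂⟩ := h₂ S' fun x hx => hS' x (.inr hx)
    exact ⟨.eq t₁' t₂', by simp only [Formula.map, ht₁, ht₂]⟩
  | rel R ts =>
    choose S hS h using fun i => (ts i).exists_finite_support
    refine ⟨⋃ i, S i, Set.finite_iUnion hS, fun S' hS' => ?_⟩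
    choose t' ht' using fun i => h i S' fun x hx => hS' x (Set.mem_iUnion_of_mem i hx)
    exact ⟨.rel R t', by simp only [Formula.map, ht']⟩
  | imp φ ψ ih₁ ih₂ =>
    obtain ⟨S₁, hS₁, h₁⟩ := ih₁
    obtain ⟨S₂, hS₂, h₂⟩ := ih₂
    refine ⟨S₁ ∪ S₂, hS₁.union hS₂, fun S' hS' => ?_⟩
    obtain ⟨φ', hφ⟩ := h₁ S' fun x hx => hS' x (.inl hx)
    obtain ⟨ψ', hψ⟩ := h₂ S' fun x hx => hS' x (.inr hx)
    exact ⟨.imp φ' ψ', by simp only [Formula.map, hφ, hψ]⟩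
  | all φ ih =>
    obtain ⟨S, hS, h⟩ := ih
    refine ⟨S, hS, fun S' hS' => ?_⟩
    obtain ⟨φ', hφ⟩ := h S' hS'
    exact ⟨.all φ', by simp only [Formula.map, hφ]⟩

/-- Every formula with parameters from `W` arises by substituting a finite tuple of parameters. -/
theorem Formula.exists_map_env_eq {V W : L.Srt → Type u} {Δ : List L.Srt}
    (φ : Formula L (fun s => V s ⊕ W s) Δ) :
    ∃ (Γ : List L.Srt) (a : ∀ s, BVar Γ s → W s) (ψ : Formula L (fun s => V s ⊕ BVar Γ s) Δ),
      ψ.map (fun s => Sum.map id (a s)) = φ := by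
  obtain ⟨S, hS, h⟩ := φ.exists_finite_support
  obtain ⟨Γ, a, ha⟩ := exists_env_covering S hS
  -- With the range of `a` as the set of parameters, each parameter is replaced by a chosen position
  -- at which `a` takes it.
  obtain ⟨φ', hφ'⟩ := h (fun s => {x | ∃ y, a s y = x}) ha
  refine ⟨Γ, a, φ'.map fun s => Sum.map id fun x => x.2.choose, ?_⟩
  rw [Formula.map_map, ← hφ']
  congr 1
  funext s x
  rcases x with x | x
  · rfl
  · exact congrArg Sum.inr x.2.choose_spec

/-! ### The number of formulas -/

/-- Nodes of syntax trees, with variables from `N`. -/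
inductive Node (L : Language.{u}) (N : Type u) : Type u
  | var (x : N)
  | app (f : L.Func)
  | falsum
  | eq
  | rel (R : L.Rel)
  | imp
  | all (s : L.Srt)

/-- The number of children of a node. -/
def Node.children {L : Language.{u}} {N : Type u} : Node L N → ℕ
  | .var _ => 0
  | .app f => L.arity f
  | .falsum => 0
  | .eq => 2
  | .rel R => L.relArity R
  | .imp => 2
  | .all _ => 1

/-- Syntax trees. -/
abbrev Tree (L : Language.{u}) (N : Type u) : Type u :=
  WType fun x : Node L N => Fin x.children

theorem Tree.mk_inj {N : Type u} {x y : Node L N} {f : Fin x.children → Tree L N}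
    {g : Fin y.children → Tree L N} (h : (WType.mk x f : Tree L N) = WType.mk y g) :
    x = y ∧ f ≍ g := by
  cases h
  exact ⟨rfl, HEq.rfl⟩

/-- The syntax tree of a term. -/
def Term.tree {V : L.Srt → Type u} {N : Type u} (n : ∀ s, V s → N) :
    ∀ {s}, Term L V s → Tree L N
  | _, .var x => .mk (.var (n _ x)) Fin.elim0
  | _, .app f ts => .mk (.app f) fun i => (ts i).tree n

/-- The sorts are not assumed equal, since the tree of an equation does not record the sort of its
two sides; the root symbol or the variable name recovers it. -/
theorem Term.tree_injective {V : L.Srt → Type u} {N : Type u} (n : ∀ s, V s → N)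
    (hn : ∀ s x t y, n s x = n t y → (⟨s, x⟩ : Σ r, V r) = ⟨t, y⟩) {s : L.Srt}
    (t : Term L V s) : ∀ {s' : L.Srt} (t' : Term L V s'), t.tree n = t'.tree n →
      (⟨s, t⟩ : Σ r, Term L V r) = ⟨s', t'⟩ := by
  induction t with
  | var x =>
    intro s' t' h
    cases t' with
    | var y =>
      cases hn _ _ _ _ (Node.var.inj (Tree.mk_inj h).1)
      rfl
    | app g ts => cases (Tree.mk_inj h).1
  | app f ts ih =>
    intro s' t' h
    cases t' with
    | var y => cases (Tree.mk_inj h).1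
    | app g ts' =>
      obtain ⟨h', h⟩ := Tree.mk_inj h
      cases h'
      have h := eq_of_heq h
      have : ts = ts' := by
        funext i
        exact eq_of_heq (Sigma.mk.inj (ih i (ts' i) (congrFun h i))).2
      rw [this]

/-- The name of a variable in a syntax tree. -/
def varName {V : L.Srt → Type u} {Γ : List L.Srt} (s : L.Srt) :
    V s ⊕ BVar Γ s → (Σ s, V s) ⊕ ULift.{u} ℕ :=
  Sum.map (fun x => ⟨s, x⟩) fun x => ⟨x.index⟩

theorem varName_injective {V : L.Srt → Type u} {Γ : List L.Srt} (s : L.Srt) (x : V s ⊕ BVar Γ s)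
    (t : L.Srt) (y : V t ⊕ BVar Γ t) (h : varName s x = varName t y) :
    (⟨s, x⟩ : Σ r, V r ⊕ BVar Γ r) = ⟨t, y⟩ := by
  rcases x with x | x <;> rcases y with y | y <;> simp [varName] at h
  · obtain ⟨rfl, h⟩ := h
    cases h
    rfl
  · cases BVar.index_injective x y h
    rfl

/-- The syntax tree of a formula. -/
def Formula.tree {V : L.Srt → Type u} :
    ∀ {Γ}, Formula L V Γ → Tree L ((Σ s, V s) ⊕ ULift.{u} ℕ)
  | _, .falsum => .mk .falsum Fin.elim0
  | _, .eq t₁ t₂ => .mk .eq ![t₁.tree varName, t₂.tree varName]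
  | _, .rel R ts => .mk (.rel R) fun i => (ts i).tree varName
  | _, .imp φ ψ => .mk .imp ![φ.tree, ψ.tree]
  | _, .all (s := s) φ => .mk (.all s) ![φ.tree]

/-- Formulas are counted through this embedding into a W-type with finite branching, whose size is
controlled by the number of labels. -/
theorem Formula.tree_injective {V : L.Srt → Type u} {Γ : List L.Srt} (φ : Formula L V Γ) :
    ∀ ψ : Formula L V Γ, φ.tree = ψ.tree → φ = ψ := by
  induction φ with
  | falsum =>
    intro ψ h
    cases ψ <;> cases (Tree.mk_inj h).1
    rfl
  | eq t₁ t₂ =>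
    intro ψ h
    cases ψ <;> obtain ⟨h', h⟩ := Tree.mk_inj h <;> cases h'
    cases Term.tree_injective _ varName_injective t₁ _ (congrFun (eq_of_heq h) 0)
    cases Term.tree_injective _ varName_injective t₂ _ (congrFun (eq_of_heq h) 1)
    rfl
  | rel R ts =>
    intro ψ h
    cases ψ <;> obtain ⟨h', h⟩ := Tree.mk_inj h <;> cases h'
    congr 1
    funext i
    exact eq_of_heq (Sigma.mk.inj
      (Term.tree_injective _ varName_injective _ _ (congrFun (eq_of_heq h) i))).2
  | imp φ ψ ih₁ ih₂ =>
    intro χ h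
    cases χ <;> obtain ⟨h', h⟩ := Tree.mk_inj h <;> cases h'
    rw [ih₁ _ (congrFun (eq_of_heq h) 0), ih₂ _ (congrFun (eq_of_heq h) 1)]
  | all φ ih =>
    intro ψ h
    cases ψ <;> obtain ⟨h', h⟩ := Tree.mk_inj h <;> cases h'
    rw [ih _ (congrFun (eq_of_heq h) 0)]

open Cardinal in
theorem Language.aleph0_le_card (L : Language.{u}) : ℵ₀ ≤ L.card := le_max_left _ _

open Cardinal in
theorem mk_node_le {N : Type u} {c : Cardinal.{u}} (hc : ℵ₀ ≤ c) (hN : #N ≤ c) (hL : L.card ≤ c) :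
    #(Node L N) ≤ c := by
  have h : #(Node L N) ≤ #(N ⊕ (L.Srt ⊕ L.Func) ⊕ L.Rel ⊕ ULift.{u} (Fin 3)) := by
    refine mk_le_of_injective (f := fun x => match x with
      | .var x => .inl x
      | .app f => .inr (.inl (.inr f))
      | .falsum => .inr (.inr (.inr ⟨0⟩))
      | .eq => .inr (.inr (.inr ⟨1⟩))
      | .rel R => .inr (.inr (.inl R))
      | .imp => .inr (.inr (.inr ⟨2⟩))
      | .all s => .inr (.inl (.inl s))) ?_
    intro x y h
    cases x <;> cases y <;> simp_all
  refine h.trans ?_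
  have hL' : #L.Srt + #L.Func + #L.Rel ≤ c := (le_max_right _ _).trans hL
  have h3 : #(ULift.{u} (Fin 3)) ≤ c := (lt_aleph0_of_finite _).le.trans hc
  simp only [mk_sum, lift_id] at *
  refine add_le_of_le hc hN (add_le_of_le hc ((self_le_add_right _ _).trans hL') ?_)
  exact add_le_of_le hc ((self_le_add_left _ _).trans hL') (by simpa using h3)

open Cardinal in
/-- The number of formulas with fixed de Bruijn variables. -/
theorem mk_formula_le {V : L.Srt → Type u} {c : Cardinal.{u}} (hL : L.card ≤ c)
    (hV : #(Σ s, V s) ≤ c) (Γ : List L.Srt) : #(Formula L V Γ) ≤ c := by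
  have hc := L.aleph0_le_card.trans hL
  refine (mk_le_of_injective (f := Formula.tree) fun φ ψ h => φ.tree_injective ψ h).trans ?_
  refine WType.cardinalMk_le_max_aleph0_of_finite'.trans (max_le ?_ hc)
  rw [lift_uzero]
  refine mk_node_le hc ?_ hL
  rw [mk_sum]
  refine add_le_of_le hc (by simpa using hV) (by simpa using hc)

end ManySorted

open Cardinal

namespace ManySorted

variable {L : Language.{u}} {C : Struct L} {κ : Cardinal.{u}}

/-! ### Homogeneity and saturation for indexed tuples -/

theorem mk_sigma_sum_lt {A : Type u} {V W : A → Type u} (hκ : ℵ₀ ≤ κ) (hV : #(Σ s, V s) < κ)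
    (hW : #(Σ s, W s) < κ) : #(Σ s, V s ⊕ W s) < κ := by
  rw [mk_congr (Equiv.sigmaSumDistrib V W), ← add_def]
  exact add_lt_of_lt hκ hV hW

theorem size_range_lt {V : L.Srt → Type u} (hV : #(Σ s, V s) < κ)
    (v : ∀ s, V s → C.carrier s) : size (fun s => Set.range (v s)) < κ := by
  refine (mk_le_of_surjective (f := fun x : Σ s, V s =>
    (⟨x.1, ⟨v x.1 x.2, x.2, rfl⟩⟩ : Σ s, Set.range (v s))) ?_).trans_lt hV
  rintro ⟨s, _, x, rfl⟩
  exact ⟨⟨s, x⟩, rfl⟩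

theorem IsStronglyHomogeneous.exists_aut_of_holds (hC : IsStronglyHomogeneous C κ)
    {V : L.Srt → Type u} (hV : #(Σ s, V s) < κ) (v w : ∀ s, V s → C.carrier s)
    (h : ∀ φ : Formula L V [], φ.Holds C v ↔ φ.Holds C w) :
    ∃ σ : Aut C, ∀ s x, σ.1 s (v s x) = w s x := by
  let g : ∀ s, Set.range (v s) → V s := fun s a => a.2.choose
  have hg : ∀ s a, v s (g s a) = a.1 := fun s a => a.2.choose_spec
  obtain ⟨σ, hσ, h'⟩ := hC _ (size_range_lt hV v) (fun s a => w s (g s a)) fun φ => by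
    have := h (φ.map g)
    simp only [Formula.Holds, Formula.realize_map, hg] at this ⊢
    exact this
  refine ⟨⟨σ, hσ⟩, fun s x => ?_⟩
  -- The index chosen for the value `v s x` may differ from `x`. The equation between the two
  -- variables holds at `v`, hence at `w`, so the choice does not matter.
  have hx : v s x = v s (g s ⟨v s x, x, rfl⟩) := (hg s ⟨_, x, rfl⟩).symm
  have := (h (.eq (.var (.inl x)) (.var (.inl (g s ⟨v s x, x, rfl⟩))))).1 hx
  exact (h' s ⟨_, x, rfl⟩).trans this.symm

theorem IsMonster.exists_aut (hC : IsMonster C κ) {V : L.Srt → Type u} (hV : #(Σ s, V s) < κ)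
    {Γ : List L.Srt} (v w : ∀ s, V s → C.carrier s) (e e' : ∀ s, BVar Γ s → C.carrier s)
    (h : ∀ φ : Formula L V Γ, φ.Realize C v e ↔ φ.Realize C w e') :
    ∃ σ : Aut C, (∀ s x, σ.1 s (v s x) = w s x) ∧ ∀ s x, σ.1 s (e s x) = e' s x := by
  have hκ := hC.strongLimit.aleph0_le
  obtain ⟨σ, hσ⟩ := hC.homogeneous.exists_aut_of_holds
    (mk_sigma_sum_lt hκ hV ((lt_aleph0_of_finite (Σ s, BVar Γ s)).trans_le hκ))
    (fun s => Sum.elim (v s) (e s)) (fun s => Sum.elim (w s) (e' s)) fun φ => by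
      rw [← Formula.realize_bind, ← Formula.realize_bind, h]
  exact ⟨σ, fun s x => hσ s (.inl x), fun s x => hσ s (.inr x)⟩

theorem IsSaturated.exists_realize_of_var (hC : IsSaturated C κ) {V : L.Srt → Type u}
    (hV : #(Σ s, V s) < κ) (v : ∀ s, V s → C.carrier s) {t : L.Srt} (p : Set (Formula L V [t]))
    (hp : ∀ l : List (Formula L V [t]), (∀ φ ∈ l, φ ∈ p) →
      ∃ b, ∀ φ ∈ l, φ.Realize C v (consEnv b emptyEnv)) :
    ∃ b, ∀ φ ∈ p, φ.Realize C v (consEnv b emptyEnv) := by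
  classical
  let f : Formula L V [t] → Formula L (fun s => Set.range (v s)) [t] :=
    Formula.map fun s x => ⟨v s x, x, rfl⟩
  have hf : ∀ φ e, (f φ).Realize C (fun _ a => a.1) e ↔ φ.Realize C v e :=
    fun φ e => Formula.realize_map _ _ _ _ _
  obtain ⟨b, hb⟩ := hC _ (size_range_lt hV v) t (f '' p) fun F hF => by
    obtain ⟨F', hF', rfl⟩ := Finset.subset_set_image_iff.1 hF
    obtain ⟨b, hb⟩ := hp F'.toList fun φ hφ => hF' (by simpa using hφ)
    refine ⟨b, fun φ hφ => ?_⟩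
    obtain ⟨ψ, hψ, rfl⟩ := Finset.mem_image.1 hφ
    exact (hf _ _).2 (hb ψ (by simpa using hψ))
  exact ⟨b, fun φ hφ => (hf _ _).1 (hb _ ⟨φ, hφ, rfl⟩)⟩

/-- Induction on the number of variables: the tail is realized first, against the existential
closures of finite conjunctions from `p`; the head is then found by saturation in one variable over
`v` and the tail. -/
theorem IsMonster.exists_realize (hC : IsMonster C κ) : ∀ {Γ : List L.Srt} {V : L.Srt → Type u}
    (_ : #(Σ s, V s) < κ) (v : ∀ s, V s → C.carrier s) (p : Set (Formula L V Γ))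
    (_ : ∀ l : List (Formula L V Γ), (∀ φ ∈ l, φ ∈ p) → ∃ e, ∀ φ ∈ l, φ.Realize C v e),
    ∃ e, ∀ φ ∈ p, φ.Realize C v e
  | [], _, _, _, p, hp => by
    refine ⟨emptyEnv, fun φ hφ => ?_⟩
    obtain ⟨e, he⟩ := hp [φ] (by simpa using hφ)
    simpa [env_nil_eq e] using he
  | t :: Γ, V, hV, v, p, hp => by
    obtain ⟨e, he⟩ := exists_realize hC hV v
      {ψ | ∃ l : List (Formula L V (t :: Γ)), (∀ φ ∈ l, φ ∈ p) ∧ ψ = (Formula.conj l).ex} (by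
        intro l hl
        choose! g hg using hl
        obtain ⟨e, he⟩ := hp (l.flatMap g) (by
          intro φ hφ
          obtain ⟨ψ, hψ, hφ⟩ := List.mem_flatMap.1 hφ
          exact (hg ψ hψ).1 φ hφ)
        refine ⟨fun s x => e s x.succ, fun ψ hψ => ?_⟩
        rw [(hg ψ hψ).2, Formula.realize_ex]
        refine ⟨e t .zero, ?_⟩
        rw [consEnv_eta, Formula.realize_conj]
        exact fun φ hφ => he φ (List.mem_flatMap.2 ⟨ψ, hψ, hφ⟩))
    have hκ := hC.strongLimit.aleph0_le
    obtain ⟨b, hb⟩ := hC.saturated.exists_realize_of_var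
      (mk_sigma_sum_lt hκ hV ((lt_aleph0_of_finite (Σ s, BVar Γ s)).trans_le hκ))
      (fun s => Sum.elim (v s) (e s)) (Formula.unbindTail '' p) (by
        intro l hl
        have : Nonempty (Formula L V (t :: Γ)) := ⟨.falsum⟩
        choose! g hg using hl
        have := he _ ⟨l.map g, by simpa using fun φ hφ => (hg φ hφ).1, rfl⟩
        obtain ⟨b, hb⟩ := (Formula.realize_ex _ _).1 this
        rw [Formula.realize_conj] at hb
        refine ⟨b, fun φ hφ => ?_⟩
        rw [← (hg φ hφ).2, Formula.realize_unbindTail]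
        exact hb _ (List.mem_map_of_mem hφ))
    exact ⟨consEnv b e, fun φ hφ => (Formula.realize_unbindTail _ _ _).1 (hb _ ⟨φ, hφ, rfl⟩)⟩

/-! ### Coheirs -/

/-- A tuple realizes the average type over `v` of an ultrafilter on tuples. -/
theorem IsMonster.exists_realize_average (hC : IsMonster C κ) {Γ : List L.Srt} {V : L.Srt → Type u}
    (hV : #(Σ s, V s) < κ) (v : ∀ s, V s → C.carrier s) {J : Type*} (U : Ultrafilter J)
    (m : J → ∀ s, BVar Γ s → C.carrier s) :
    ∃ c, ∀ φ : Formula L V Γ, φ.Realize C v c ↔ ∀ᶠ j in U, φ.Realize C v (m j) := by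
  obtain ⟨c, hc⟩ := hC.exists_realize hV v {φ | ∀ᶠ j in U, φ.Realize C v (m j)} fun l hl => by
    have : ∀ᶠ j in U, (Formula.conj l).Realize C v (m j) := by
      simp only [Formula.realize_conj]
      exact (Filter.eventually_all_finite (l.finite_toSet)).2 hl
    obtain ⟨j, hj⟩ := this.exists
    exact ⟨_, (Formula.realize_conj _ _).1 hj⟩
  refine ⟨c, fun φ => ⟨fun h => ?_, hc φ⟩⟩
  by_contra h'
  exact hc φ.not (Ultrafilter.eventually_not.2 h') h

/-- Elementarity is used twice: downwards for the existential closure of `φ`, which gives a tuple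
`m` in `M`, and upwards for `φ` with `m` substituted as parameters. -/
theorem Substr.IsElementary.exists_realize {M : Substr C} (hM : M.IsElementary) {Γ : List L.Srt}
    (φ : Formula L (fun s => M.carrier s) Γ) {a : ∀ s, BVar Γ s → C.carrier s}
    (h : φ.Realize C (fun _ a => a.1) a) :
    ∃ m : ∀ s, BVar Γ s → M.carrier s, φ.Realize C (fun _ a => a.1) fun s x => (m s x).1 := by
  obtain ⟨m, hm⟩ : ∃ m : ∀ s, BVar Γ s → M.carrier s, φ.Realize M.toStruct (fun _ a => a) m :=
    (Formula.realize_exs φ).1 ((hM φ.exs).2 ((Formula.realize_exs φ).2 ⟨a, h⟩))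
  refine ⟨m, ?_⟩
  let ψ : Formula L (fun s => M.carrier s) [] :=
    φ.unbind.map fun s => Sum.elim id (m s)
  have h₁ : ∀ (D : Struct L) (v : ∀ s, M.carrier s → D.carrier s),
      ψ.Holds D v ↔ φ.Realize D v fun s x => v s (m s x) := by
    intro D v
    rw [← Formula.holds_unbind]
    unfold ψ Formula.Holds
    rw [Formula.realize_map]
    refine iff_of_eq (congrArg (fun w => Formula.Realize D w _ _) ?_)
    funext s x
    cases x <;> rfl
  exact (h₁ _ _).1 ((hM ψ).1 ((h₁ M.toStruct fun _ a => a).2 hm))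

/-- The type of a tuple over an elementary submodel is the average type of an ultrafilter on the
tuples from the submodel. -/
theorem Substr.IsElementary.exists_ultrafilter {M : Substr C} (hM : M.IsElementary)
    {Γ : List L.Srt} (a : ∀ s, BVar Γ s → C.carrier s) :
    ∃ U : Ultrafilter (∀ s, BVar Γ s → M.carrier s),
      ∀ φ : Formula L (fun s => M.carrier s) Γ, φ.Realize C (fun _ a => a.1) a ↔
        ∀ᶠ m : ∀ s, BVar Γ s → M.carrier s in (U : Filter _),
          φ.Realize C (fun _ a => a.1) fun s x => (m s x).1 := by
  let B : Formula L (fun s => M.carrier s) Γ → Set (∀ s, BVar Γ s → M.carrier s) := fun φ =>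
    {m | φ.Realize C (fun _ a => a.1) fun s x => (m s x).1}
  -- Finite intersection property: the conjunction of finitely many formulas true of `a` is
  -- satisfied by a tuple from `M`.
  have : (Filter.generate (B '' {φ | φ.Realize C (fun _ a => a.1) a})).NeBot := by
    classical
    rw [Filter.generate_neBot_iff]
    intro t ht htf
    obtain ⟨t, rfl⟩ := htf.exists_finset_coe
    obtain ⟨F, hF, rfl⟩ := Finset.subset_set_image_iff.1 ht
    obtain ⟨m, hm⟩ := hM.exists_realize (Formula.conj F.toList) (a := a)
      ((Formula.realize_conj _ _).2 fun φ hφ => hF (by simpa using hφ))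
    refine ⟨m, ?_⟩
    rw [Formula.realize_conj] at hm
    simpa [B] using hm
  have key : ∀ φ : Formula L (fun s => M.carrier s) Γ, φ.Realize C (fun _ a => a.1) a →
      ∀ᶠ m : ∀ s, BVar Γ s → M.carrier s in (Ultrafilter.of
          (Filter.generate (B '' {φ | φ.Realize C (fun _ a => a.1) a})) : Filter _),
        φ.Realize C (fun _ a => a.1) fun s x => (m s x).1 := fun φ h =>
    Ultrafilter.of_le _ (Filter.mem_generate_of_mem ⟨φ, h, rfl⟩)
  refine ⟨Ultrafilter.of _, fun φ => ⟨key φ, fun h => ?_⟩⟩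
  by_contra h'
  exact Ultrafilter.eventually_not.1 (key φ.not h') h

/-! ### Bounded invariant equivalence relations -/

/-- An invariant equivalence relation on finite tuples with a bounded number of classes does not
separate tuples with the same type over a small submodel. -/
theorem IsMonster.eq_of_bounded_invariant (hC : IsMonster C κ) {Γ : List L.Srt} {Z : Type u}
    (hZ : #Z < κ) (F : (∀ s, BVar Γ s → C.carrier s) → Z)
    (hF : ∀ (σ : Aut C) x y, F x = F y →
      F (fun s i => σ.1 s (x s i)) = F fun s i => σ.1 s (y s i))
    {M : Substr C} (hM : M.IsElementary) (hMκ : size M.carrier < κ)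
    (a b : ∀ s, BVar Γ s → C.carrier s)
    (hab : ∀ φ : Formula L (fun s => M.carrier s) Γ,
      φ.Realize C (fun _ a => a.1) a ↔ φ.Realize C (fun _ a => a.1) b) : F a = F b := by
  have hκ := hC.strongLimit.aleph0_le
  have hΓ : #(Σ s, BVar Γ s) < κ := (lt_aleph0_of_finite (Σ s, BVar Γ s)).trans_le hκ
  obtain ⟨U, hU⟩ := hM.exists_ultrafilter a
  let val : (∀ s, BVar Γ s → M.carrier s) → ∀ s, BVar Γ s → C.carrier s := fun m s x => (m s x).1
  -- The base consists of `M`, `a`, `b` and one representative of each class of `F`; boundedness of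
  -- `F` keeps it smaller than `κ`.
  let V : L.Srt → Type u := fun s => M.carrier s ⊕ ((BVar Γ s ⊕ BVar Γ s) ⊕ (Set.range F × BVar Γ s))
  let rep : Set.range F → ∀ s, BVar Γ s → C.carrier s := fun z => z.2.choose
  have hrep : ∀ z, F (rep z) = z.1 := fun z => z.2.choose_spec
  let v : ∀ s, V s → C.carrier s := fun s =>
    Sum.elim Subtype.val (Sum.elim (Sum.elim (a s) (b s)) fun y => rep y.1 s y.2)
  have hV : #(Σ s, V s) < κ := by
    refine mk_sigma_sum_lt hκ hMκ (mk_sigma_sum_lt hκ (mk_sigma_sum_lt hκ hΓ hΓ) ?_)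
    refine lt_of_le_of_lt (mk_le_of_injective (β := Set.range F × Σ s, BVar Γ s)
      (f := fun x => (x.2.1, ⟨x.1, x.2.2⟩)) ?_) ?_
    · rintro ⟨s, z, x⟩ ⟨t, z', y⟩ h
      simp only [Prod.mk.injEq, Sigma.mk.injEq] at h
      obtain ⟨rfl, rfl, h⟩ := h
      cases h
      rfl
    · rw [← mul_def]
      exact mul_lt_of_lt hκ ((mk_set_le _).trans_lt hZ) hΓ
  -- Two steps of a coheir sequence: `c` realizes the average of `U` over the base, and `c'`
  -- realizes it over the base together with `c`.
  obtain ⟨c, hc⟩ := hC.exists_realize_average hV v U val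
  obtain ⟨c', hc'⟩ := hC.exists_realize_average (mk_sigma_sum_lt hκ hV hΓ)
    (fun s => Sum.elim (v s) (c s)) U val
  -- Some automorphism takes `c` to `c'` and fixes the base, in particular the representative of the
  -- class of `c`; by invariance `c'` lies in the same class.
  have hcc' : F c = F c' := by
    obtain ⟨σ, hσ, hσc⟩ := hC.exists_aut hV v v c c' fun φ => by
      rw [hc]
      have := hc' (φ.map fun _ => Sum.inl)
      simp only [Formula.realize_map, Sum.elim_inl] at this
      exact this.symm
    have h := hF σ c (rep ⟨F c, c, rfl⟩) (hrep ⟨F c, c, rfl⟩).symm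
    have h₁ : (fun s i => σ.1 s (c s i)) = c' := by
      funext s i
      exact hσc s i
    have h₂ : (fun s i => σ.1 s (rep ⟨F c, c, rfl⟩ s i)) = rep ⟨F c, c, rfl⟩ := by
      funext s i
      exact hσ s (.inr (.inr (⟨F c, c, rfl⟩, i)))
    rw [h₁, h₂, hrep] at h
    exact h.symm
  have hcM : ∀ φ : Formula L (fun s => M.carrier s) Γ,
      φ.Realize C (fun _ a => a.1) c ↔ φ.Realize C (fun _ a => a.1) a := by
    intro φ
    have := hc (φ.map fun _ => Sum.inl)
    simp only [Formula.realize_map] at this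
    exact this.trans (hU φ).symm
  -- For `x` in the base with the type of `c` over `M`, the pairs `(c, c')` and `(x, c')` have the
  -- same type, because `c'` averages tuples from `M`. An automorphism thus carries `F c = F c'` to
  -- `F x = F c'`; it is applied to `x = a` and to `x = b`.
  have key : ∀ (x : ∀ s, BVar Γ s → C.carrier s) (i : ∀ s, BVar Γ s → V s),
      (∀ s y, v s (i s y) = x s y) → (∀ φ : Formula L (fun s => M.carrier s) Γ,
        φ.Realize C (fun _ a => a.1) c ↔ φ.Realize C (fun _ a => a.1) x) → F x = F c' := by
    intro x i hi hx
    obtain ⟨σ, hσ, hσ'⟩ := hC.exists_aut hΓ c x c' c' fun φ => by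
      have h₁ := hc' (φ.map fun s y => .inr y)
      have h₂ := hc' (φ.map fun s y => .inl (i s y))
      simp only [Formula.realize_map, Sum.elim_inl, Sum.elim_inr, hi] at h₁ h₂
      refine h₁.trans (Iff.trans (Filter.eventually_congr (.of_forall fun m => ?_)) h₂.symm)
      let ψ : Formula L (fun s => M.carrier s) Γ :=
        Formula.bind (φ.unbind.map fun s => Sum.elim .inr fun y => .inl (m s y))
      have hψ : ∀ z, ψ.Realize C (fun _ a => a.1) z ↔ φ.Realize C z (val m) := by
        intro z
        rw [Formula.realize_bind, ← Formula.holds_unbind]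
        unfold Formula.Holds
        rw [Formula.realize_map]
        refine iff_of_eq (congrArg (fun w => Formula.Realize C w _ _) ?_)
        funext s y
        cases y <;> rfl
      rw [← hψ, ← hψ]
      exact hx ψ
    have h := hF σ c c' hcc'
    have h₁ : (fun s i => σ.1 s (c s i)) = x := by
      funext s i
      exact hσ s i
    have h₂ : (fun s i => σ.1 s (c' s i)) = c' := by
      funext s i
      exact hσ' s i
    rwa [h₁, h₂] at h
  exact (key a (fun s y => .inr (.inl (.inl y))) (fun _ _ => rfl) hcM).trans
    (key b (fun s y => .inr (.inl (.inr y))) (fun _ _ => rfl)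
      fun φ => (hcM φ).trans (hab φ)).symm

/-! ### Small elementary submodels -/

theorem Substr.eval_val (M : Substr C) {V : L.Srt → Type u} (w : ∀ s, V s → M.carrier s)
    {s : L.Srt} (t : Term L V s) :
    (t.eval M.toStruct w).1 = t.eval C fun s x => (w s x).1 := by
  induction t with
  | var x => rfl
  | app f ts ih =>
    change C.func f (fun i => ((ts i).eval M.toStruct w).1) = C.func f _
    simp only [ih]

/-- The Tarski–Vaught test. -/
theorem Substr.isElementary_of_exists (M : Substr C)
    (h : ∀ (Γ : List L.Srt) (s : L.Srt) (φ : Formula L (fun _ => PEmpty.{u + 1}) (s :: Γ))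
      (e : ∀ s, BVar Γ s → M.carrier s) (b : C.carrier s),
      φ.Realize C (fun _ => PEmpty.elim) (consEnv b fun s x => (e s x).1) →
      ∃ b : M.carrier s, φ.Realize C (fun _ => PEmpty.elim) (consEnv b.1 fun s x => (e s x).1)) :
    M.IsElementary := by
  have key : ∀ {Γ : List L.Srt} (φ : Formula L (fun _ => PEmpty.{u + 1}) Γ)
      (e : ∀ s, BVar Γ s → M.carrier s),
      φ.Realize M.toStruct (fun _ => PEmpty.elim) e ↔
        φ.Realize C (fun _ => PEmpty.elim) fun s x => (e s x).1 := by
    have hval : ∀ {Γ : List L.Srt} (e : ∀ s, BVar Γ s → M.carrier s) {s : L.Srt}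
        (t : Term L (fun s => PEmpty.{u + 1} ⊕ BVar Γ s) s),
        (t.eval M.toStruct fun s => Sum.elim PEmpty.elim (e s)).1 =
          t.eval C fun s => Sum.elim PEmpty.elim fun x => (e s x).1 := by
      intro Γ e s t
      refine (M.eval_val (fun s => Sum.elim PEmpty.elim (e s)) t).trans
        (congrArg (fun w => t.eval C w) ?_)
      funext s x
      rcases x with x | x
      · exact x.elim
      · rfl
    intro Γ φ
    induction φ with
    | falsum => intro e; rfl
    | eq t₁ t₂ =>
      intro e
      refine Subtype.ext_iff.trans ?_
      rw [hval e t₁, hval e t₂]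
      rfl
    | rel R ts =>
      intro e
      change C.rel R (fun i => ((ts i).eval M.toStruct _).1) ↔ C.rel R _
      simp only [hval e]
    | imp φ ψ ih₁ ih₂ =>
      intro e
      exact imp_congr (ih₁ e) (ih₂ e)
    | @all Γ s φ ih =>
      intro e
      have hcons : ∀ b : M.carrier s, (fun r x => (consEnv (D := fun r => M.carrier r) b e r x).1) =
          consEnv b.1 fun r x => (e r x).1 := by
        intro b
        funext r x
        cases x <;> rfl
      have ih' : ∀ b : M.carrier s, φ.Realize M.toStruct (fun _ => PEmpty.elim) (consEnv b e) ↔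
          φ.Realize C (fun _ => PEmpty.elim) (consEnv b.1 fun r x => (e r x).1) := by
        intro b
        rw [← hcons]
        exact ih _
      constructor
      · intro hM b
        by_contra hb
        obtain ⟨b', hb'⟩ := h _ _ φ.not e b hb
        exact hb' ((ih' b').1 (hM b'))
      · exact fun hC b => (ih' b).2 (hC b.1)
  intro φ
  -- The finitely many parameters of `φ` become values of de Bruijn variables, which reduces to the
  -- parameter-free case `key`.
  obtain ⟨Γ, a, ψ, hψ⟩ := Formula.exists_map_env_eq
    (φ.map fun s (x : M.carrier s) => (.inr x : PEmpty.{u + 1} ⊕ M.carrier s))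
  have hφ : ∀ (D : Struct L) (v : ∀ s, M.carrier s → D.carrier s),
      φ.Holds D v ↔ ψ.bind.Realize D (fun _ => PEmpty.elim) fun s x => v s (a s x) := by
    intro D v
    have h₁ : φ.Holds D v ↔ (φ.map fun s (x : M.carrier s) =>
        (.inr x : PEmpty.{u + 1} ⊕ M.carrier s)).Holds D fun s => Sum.elim PEmpty.elim (v s) := by
      unfold Formula.Holds
      rw [Formula.realize_map]
      rfl
    rw [h₁, ← hψ, Formula.realize_bind]
    unfold Formula.Holds
    rw [Formula.realize_map]
    refine iff_of_eq (congrArg (fun w => Formula.Realize D w _ _) ?_)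
    funext s x
    cases x <;> rfl
  exact (hφ M.toStruct _).trans ((key _ _).trans (hφ C _).symm)

/-- Closure of the empty set under a family of finitary operations. -/
theorem exists_closed_set {X α : Type u} {β : α → Type u} [∀ a, Finite (β a)]
    (op : ∀ a, (β a → X) → X) :
    ∃ S : Set X, #S ≤ max #α ℵ₀ ∧ ∀ a f, (∀ b, f b ∈ S) → op a f ∈ S := by
  refine ⟨Set.range (WType.elim X fun x : Σ a, β a → X => op x.1 x.2),
    mk_range_le.trans WType.cardinalMk_le_max_aleph0_of_finite, fun a f hf => ?_⟩
  choose g hg using hf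
  exact ⟨.mk a g, by simp only [WType.elim, hg]⟩

/-- The downward Löwenheim–Skolem theorem. -/
theorem exists_isElementary_size_le (C : Struct L) :
    ∃ M : Substr C, M.IsElementary ∧ size M.carrier ≤ L.card := by
  classical
  let α : Type u := L.Func ⊕ Σ p : L.Srt × List L.Srt,
    Formula L (fun _ => PEmpty.{u + 1}) (p.1 :: p.2)
  let β : α → Type u
    | .inl f => ULift (Fin (L.arity f))
    | .inr φ => Σ s, BVar φ.1.2 s
  have hβ : ∀ a, Finite (β a) := by
    rintro (f | φ)
    · exact inferInstanceAs (Finite (ULift (Fin (L.arity f))))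
    · exact inferInstanceAs (Finite (Σ s, BVar φ.1.2 s))
  -- Function symbols and Skolem functions as total one-sorted operations: `none` is the value when
  -- the arguments have the wrong sorts or no witness exists, so empty sorts cause no trouble.
  let op : ∀ a, (β a → Option (Σ s, C.carrier s)) → Option (Σ s, C.carrier s)
    | .inl f, x =>
      if h : ∃ a : ∀ i, C.carrier (L.dom f i), ∀ i, x ⟨i⟩ = some ⟨L.dom f i, a i⟩ then
        some ⟨L.cod f, C.func f h.choose⟩ else none
    | .inr φ, x =>
      if h : ∃ (e : ∀ s, BVar φ.1.2 s → C.carrier s) (b : C.carrier φ.1.1),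
          (∀ y, x y = some ⟨y.1, e y.1 y.2⟩) ∧
            φ.2.Realize C (fun _ => PEmpty.elim) (consEnv b e) then
        some ⟨φ.1.1, h.choose_spec.choose⟩ else none
  obtain ⟨S, hS, hop⟩ := exists_closed_set op
  refine ⟨⟨fun s => {a | some ⟨s, a⟩ ∈ S}, fun f a ha => ?_⟩, ?_, ?_⟩
  · have h := hop (.inl f) (fun i => some ⟨_, a i.down⟩) fun i => ha i.down
    have h' : ∃ a' : ∀ i, C.carrier (L.dom f i), ∀ i,
        (some ⟨L.dom f i, a i⟩ : Option (Σ s, C.carrier s)) = some ⟨L.dom f i, a' i⟩ :=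
      ⟨a, fun _ => rfl⟩
    have h'' : h'.choose = a := by
      funext i
      have := h'.choose_spec i
      simpa using this.symm
    have hop' : op (.inl f) (fun i => some ⟨_, a i.down⟩) = some ⟨L.cod f, C.func f h'.choose⟩ :=
      dif_pos h'
    rw [hop', h''] at h
    exact h
  · refine Substr.isElementary_of_exists _ fun Γ s φ e b hb => ?_
    let φ' : Σ p : L.Srt × List L.Srt, Formula L (fun _ => PEmpty.{u + 1}) (p.1 :: p.2) :=
      ⟨(s, Γ), φ⟩
    have h := hop (.inr φ') (fun y => some ⟨y.1, (e y.1 y.2).1⟩) fun y => (e y.1 y.2).2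
    have h' : ∃ (e' : ∀ s, BVar Γ s → C.carrier s) (b : C.carrier s),
        (∀ y : Σ s, BVar Γ s, (some ⟨y.1, (e y.1 y.2).1⟩ : Option (Σ s, C.carrier s)) =
          some ⟨y.1, e' y.1 y.2⟩) ∧ φ.Realize C (fun _ => PEmpty.elim) (consEnv b e') :=
      ⟨fun s x => (e s x).1, b, fun _ => rfl, hb⟩
    have hop' : op (.inr φ') (fun y => some ⟨y.1, (e y.1 y.2).1⟩) =
        some ⟨s, h'.choose_spec.choose⟩ := dif_pos h'
    rw [hop'] at h
    have h₁ := h'.choose_spec.choose_spec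
    have h₂ : h'.choose = fun s x => (e s x).1 := by
      funext r x
      have := h₁.1 ⟨r, x⟩
      simpa using this.symm
    exact ⟨⟨_, h⟩, (congrArg (fun w => Formula.Realize C (fun _ => PEmpty.elim) φ
      (consEnv h'.choose_spec.choose w)) h₂).mp h₁.2⟩
  · refine (mk_le_of_injective (β := S) (f := fun x => ⟨some ⟨x.1, x.2.1⟩, x.2.2⟩) ?_).trans
      (hS.trans (max_le ?_ L.aleph0_le_card))
    · rintro ⟨s, a, ha⟩ ⟨t, b, hb⟩ h
      simp only [Subtype.mk.injEq, Option.some.injEq, Sigma.mk.injEq] at h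
      obtain ⟨rfl, h⟩ := h
      cases h
      rfl
    · have hc := L.aleph0_le_card
      have hL : #L.Srt + #L.Func + #L.Rel ≤ L.card := le_max_right _ _
      have hSrt : #L.Srt ≤ L.card :=
        (self_le_add_right _ _).trans ((self_le_add_right _ _).trans hL)
      have hFunc : #L.Func ≤ L.card :=
        (self_le_add_left _ _).trans ((self_le_add_right _ _).trans hL)
      have h1 : #(L.Srt × List L.Srt) ≤ L.card := by
        rw [← mul_def]
        exact mul_le_of_le hc hSrt ((mk_list_le_max _).trans (max_le hc hSrt))
      rw [← add_def, mk_sigma]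
      refine add_le_of_le hc hFunc ((sum_le_sum _ (fun _ => L.card) fun p =>
        mk_formula_le le_rfl (by simp) _).trans ?_)
      rw [sum_const']
      exact mul_le_of_le hc h1 le_rfl

/-- The preimage of a substructure under an automorphism. -/
def Substr.comap (σ : Aut C) (M : Substr C) : Substr C where
  carrier s := σ.1 s ⁻¹' M.carrier s
  func_mem f a ha := by
    rw [Set.mem_preimage, σ.2.1]
    exact M.func_mem f _ ha

/-- In the Tarski–Vaught test, `σ` moves the parameters into `M`, and a witness found there is
pulled back. -/
theorem Substr.IsElementary.comap {M : Substr C} (hM : M.IsElementary) (σ : Aut C) :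
    (M.comap σ).IsElementary := by
  refine Substr.isElementary_of_exists _ fun Γ s φ e b hb => ?_
  let e' : ∀ s, BVar Γ s → M.carrier s := fun s x => ⟨σ.1 s (e s x).1, (e s x).2⟩
  let ψ : Formula L (fun s => M.carrier s) [s] :=
    φ.unbindTail.map fun s => Sum.elim PEmpty.elim (e' s)
  have hψ : ∀ c : C.carrier s, ψ.Realize C (fun _ a => a.1) (consEnv c emptyEnv) ↔
      φ.Realize C (fun _ => PEmpty.elim) (consEnv c fun s x => (e' s x).1) := by
    intro c
    refine (Formula.realize_map _ _ _ _ _).trans (Iff.trans ?_ (Formula.realize_unbindTail _ _ _))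
    refine iff_of_eq (congrArg (fun w => Formula.Realize C w _ _) ?_)
    funext s x
    rcases x with x | x
    · exact x.elim
    · rfl
  have haut : ∀ c : C.carrier s,
      φ.Realize C (fun _ => PEmpty.elim) (consEnv (σ.1 s c) fun s x => (e' s x).1) ↔
        φ.Realize C (fun _ => PEmpty.elim) (consEnv c fun s x => (e s x).1) := by
    intro c
    rw [← Formula.realize_aut σ _ φ (consEnv c fun s x => (e s x).1)]
    have h₁ : (fun (s : L.Srt) (x : PEmpty.{u + 1}) => σ.1 s (PEmpty.elim x)) =
        fun _ => PEmpty.elim := by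
      funext s x
      exact x.elim
    have h₂ : (fun r x => σ.1 r (consEnv (D := C.carrier) c (fun s x => (e s x).1) r x)) =
        consEnv (σ.1 s c) fun s x => (e' s x).1 := by
      funext r x
      cases x <;> rfl
    rw [h₁, h₂]
  obtain ⟨m, hm⟩ := hM.exists_realize ψ ((hψ _).2 ((haut b).2 hb))
  have hm' : (fun r x => (m r x).1) = consEnv (m s .zero).1 (emptyEnv (D := C.carrier)) := by
    funext r x
    cases x with
    | zero => rfl
    | succ x => cases x
  rw [hm', hψ] at hm
  have hs : σ.1 s ((σ.1 s).symm (m s .zero).1) = (m s .zero).1 := Equiv.apply_symm_apply _ _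
  refine ⟨⟨(σ.1 s).symm (m s .zero).1, ?_⟩, ?_⟩
  · change σ.1 s _ ∈ M.carrier s
    rw [hs]
    exact (m s .zero).2
  · rw [← haut, hs]
    exact hm

theorem Substr.size_comap_le (M : Substr C) (σ : Aut C) :
    size (M.comap σ).carrier ≤ size M.carrier := by
  refine mk_le_of_injective (f := fun x => ⟨x.1, σ.1 x.1 x.2.1, x.2.2⟩) ?_
  rintro ⟨s, a, ha⟩ ⟨t, b, hb⟩ h
  simp only [Sigma.mk.injEq] at h
  obtain ⟨rfl, h⟩ := h
  have := (σ.1 s).injective (Subtype.ext_iff.1 (eq_of_heq h))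
  cases this
  rfl

/-! ### Lascar invariant types -/

theorem GlobalType.not_mem_iff {I : L.Srt → Type u} (p : GlobalType C I) (φ : GlobalFormula C I) :
    φ.not ∈ p.formulas ↔ φ ∉ p.formulas := by
  classical
  refine ⟨fun h h' => ?_, fun h => (p.complete φ).resolve_left h⟩
  obtain ⟨a, ha⟩ := p.finSat {φ, φ.not} (by simp [Set.insert_subset_iff, h, h'])
  exact ha φ.not (by simp) (ha φ (by simp))

namespace TypeSpace

variable {I : L.Srt → Type u} {X : Set (Formula L I [])}

theorem ext_of_subset {p q : TypeSpace C X} (h : ∀ φ ∈ p.1.formulas, φ ∈ q.1.formulas) :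
    p = q := by
  refine Subtype.ext (GlobalType.ext (Set.Subset.antisymm h fun φ hφ => ?_))
  by_contra h'
  exact (q.1.not_mem_iff φ).1 (h _ ((p.1.not_mem_iff φ).2 h')) hφ

/-- A stabilizer is a subgroup, so only the generators of `AutfL` have to be tested. -/
theorem mem_lascarInvariant_iff {p : TypeSpace C X} :
    p ∈ lascarInvariant X κ ↔ ∀ (M : Substr C) (σ : Aut C), M.IsElementary → size M.carrier < κ →
      (∀ s, ∀ a ∈ M.carrier s, σ.1 s a = a) → σ • p = p := by
  constructor
  · exact fun h M σ hM hs hσ => h σ (Subgroup.subset_closure ⟨M, hM, hs, hσ⟩)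
  · intro h
    have : AutfL C κ ≤ MulAction.stabilizer (Aut C) p := by
      refine (Subgroup.closure_le _).2 ?_
      rintro σ ⟨M, hM, hs, hσ⟩
      exact h M σ hM hs hσ
    exact fun σ hσ => this hσ

/-- If `σ` fixes `M` pointwise, then `τ⁻¹ * σ * τ` fixes the small elementary submodel `τ⁻¹ M`. -/
theorem smul_mem_lascarInvariant {p : TypeSpace C X} (hp : p ∈ lascarInvariant X κ) (τ : Aut C) :
    τ • p ∈ lascarInvariant X κ := by
  rw [mem_lascarInvariant_iff] at hp ⊢
  intro M σ hM hs hσ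
  have := hp (M.comap τ) (τ⁻¹ * σ * τ) (hM.comap τ) ((M.size_comap_le τ).trans_lt hs)
    fun s a ha => by
      change (τ.1 s)⁻¹ (σ.1 s (τ.1 s a)) = a
      rw [hσ s _ ha]
      exact Equiv.symm_apply_apply _ _
  rw [mul_smul, mul_smul, inv_smul_eq_iff] at this
  exact this

/-- The action of an automorphism on Lascar invariant types is determined by the type of the image
of a small submodel over this submodel. -/
theorem smul_eq_smul_of_holds_iff (hC : IsMonster C κ) {M : Substr C} (hM : M.IsElementary)
    (hs : size M.carrier < κ) {σ τ : Aut C}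
    (h : ∀ φ : Formula L (fun s => M.carrier s ⊕ M.carrier s) [],
      φ.Holds C (fun s => Sum.elim (fun a => a.1) fun a => σ.1 s a.1) ↔
        φ.Holds C (fun s => Sum.elim (fun a => a.1) fun a => τ.1 s a.1))
    {p : TypeSpace C X} (hp : p ∈ lascarInvariant X κ) : σ • p = τ • p := by
  -- `ρ` fixes `M` pointwise and `ρ * σ` agrees with `τ` on `M`. Hence `ρ` fixes `σ • p`, and `τ⁻¹ *
  -- ρ * σ` fixes `p`.
  obtain ⟨ρ, hρ⟩ := hC.homogeneous.exists_aut_of_holds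
    (mk_sigma_sum_lt hC.strongLimit.aleph0_le hs hs) _ _ h
  have h₁ : ρ • σ • p = σ • p := mem_lascarInvariant_iff.1 (smul_mem_lascarInvariant hp σ) M ρ hM hs
    fun s a ha => hρ s (.inl ⟨a, ha⟩)
  have h₂ : (τ⁻¹ * ρ * σ) • p = p := mem_lascarInvariant_iff.1 hp M _ hM hs fun s a ha => by
    change (τ.1 s)⁻¹ (ρ.1 s (σ.1 s a)) = a
    have := hρ s (.inr ⟨a, ha⟩)
    simp only [Sum.elim_inr] at this
    rw [this]
    exact Equiv.symm_apply_apply _ _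
  rw [mul_smul, mul_smul, inv_smul_eq_iff] at h₂
  exact h₁.symm.trans h₂

end TypeSpace

/-! ### Ellis semigroups -/

theorem smul_mem_ellisSemigroup {G Y : Type*} [SMul G Y] [TopologicalSpace Y] (g : G) :
    (fun y : Y => g • y) ∈ ellisSemigroup G Y :=
  subset_closure ⟨g, rfl⟩

/-- Composition with a fixed function on the right is always continuous, on the left only for
continuous functions such as group elements; so the closure is taken first in `f'`, then in `f`. -/
theorem comp_mem_ellisSemigroup {G Y : Type*} [Monoid G] [MulAction G Y] [TopologicalSpace Y]
    [ContinuousConstSMul G Y] {f f' : Y → Y} (hf : f ∈ ellisSemigroup G Y)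
    (hf' : f' ∈ ellisSemigroup G Y) : f ∘ f' ∈ ellisSemigroup G Y := by
  have h₁ : ∀ g : G, (fun y => g • y) ∘ f' ∈ ellisSemigroup G Y := fun g =>
    map_mem_closure (f := fun k : Y → Y => (fun y => g • y) ∘ k)
      (continuous_pi fun y => (continuous_apply y).const_smul g) hf' (by
        rintro _ ⟨h, rfl⟩
        exact ⟨g * h, funext fun y => mul_smul g h y⟩)
  have h₂ : f ∘ f' ∈ closure (ellisSemigroup G Y) :=
    map_mem_closure (f := fun k : Y → Y => k ∘ f') (continuous_pi fun y => continuous_apply (f' y))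
      hf (by
        rintro _ ⟨g, rfl⟩
        exact h₁ g)
  rwa [ellisSemigroup, closure_closure] at h₂

/-- A minimal left ideal is generated by each of its elements. -/
theorem IsMinimalLeftIdeal.exists_comp_eq {Y : Type*} {E M : Set (Y → Y)}
    (hM : IsMinimalLeftIdeal E M) (hE : ∀ f ∈ E, ∀ g ∈ E, f ∘ g ∈ E) {μ η : Y → Y} (hμ : μ ∈ M)
    (hη : η ∈ M) : ∃ θ ∈ E, θ ∘ μ = η := by
  -- `E ∘ μ` is a left ideal inside `M`, so it equals `M`.
  have hK : IsLeftIdeal E ((fun θ => θ ∘ μ) '' E) := by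
    refine ⟨?_, ⟨_, μ, hM.1.1 hμ, rfl⟩, ?_⟩
    · rintro _ ⟨θ, hθ, rfl⟩
      exact hE θ hθ μ (hM.1.1 hμ)
    · rintro f hf _ ⟨θ, hθ, rfl⟩
      exact ⟨f ∘ θ, hE f hf θ hθ, rfl⟩
  have hKM : (fun θ => θ ∘ μ) '' E ⊆ M := by
    rintro _ ⟨θ, hθ, rfl⟩
    exact hM.1.2.2 θ hθ μ hμ
  rw [← hM.2 _ hK hKM] at hη
  exact hη

namespace TypeSpace

variable {I : L.Srt → Type u} {X : Set (Formula L I [])}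

theorem isOpen_setOf_mem (φ : GlobalFormula C I) :
    IsOpen {p : TypeSpace C X | φ ∈ p.1.formulas} :=
  TopologicalSpace.isOpen_generateFrom_of_mem ⟨φ, rfl⟩

instance : ContinuousConstSMul (Aut C) (TypeSpace C X) where
  continuous_const_smul σ := by
    refine continuous_generateFrom_iff.2 ?_
    rintro _ ⟨φ, rfl⟩
    exact isOpen_setOf_mem (φ.applyAut σ⁻¹)

theorem isOpen_setOf_apply_mem (φ : GlobalFormula C I) (p : TypeSpace C X) :
    IsOpen {f : TypeSpace C X → TypeSpace C X | φ ∈ (f p).1.formulas} := by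
  have h : Continuous fun f : TypeSpace C X → TypeSpace C X => f p := continuous_apply p
  exact (isOpen_setOf_mem φ).preimage h

/-- A formula witnessing `σ • θ p ≠ θ p` would, by approximating `θ` at `p`, witness `σ • τ • p ≠ τ
• p` for some automorphism `τ`. -/
theorem apply_mem_lascarInvariant {θ : TypeSpace C X → TypeSpace C X}
    (hθ : θ ∈ ellisSemigroup (Aut C) (TypeSpace C X)) {p : TypeSpace C X}
    (hp : p ∈ lascarInvariant X κ) : θ p ∈ lascarInvariant X κ := by
  intro σ hσ
  refine ext_of_subset fun φ hφ => ?_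
  by_contra h
  rw [← GlobalType.not_mem_iff] at h
  obtain ⟨_, ⟨h₁, h₂⟩, τ, rfl⟩ := mem_closure_iff.1 hθ _
    ((isOpen_setOf_apply_mem (φ.applyAut σ⁻¹) p).inter (isOpen_setOf_apply_mem φ.not p)) ⟨hφ, h⟩
  have h₃ : φ ∈ (σ • τ • p).1.formulas := h₁
  rw [smul_mem_lascarInvariant hp τ σ hσ] at h₃
  exact (GlobalType.not_mem_iff _ _).1 h₂ h₃

/-- The elements of the Ellis semigroup have a bounded number of restrictions to the set of Lascar
invariant types. -/
theorem exists_code_ellisSemigroup (hC : IsMonster C κ) :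
    ∃ (Z : Type u) (D : (TypeSpace C X → TypeSpace C X) → Z),
      #Z ≤ (2 : Cardinal.{u}) ^ ((2 : Cardinal.{u}) ^ ((2 : Cardinal.{u}) ^ L.card)) ∧
      ∀ f ∈ ellisSemigroup (Aut C) (TypeSpace C X), ∀ g, D f = D g → ∀ p ∈ lascarInvariant X κ, f p = g p := by
  obtain ⟨M, hM, hs⟩ := exists_isElementary_size_le C
  let tp : Aut C → Set (Formula L (fun s => M.carrier s ⊕ M.carrier s) []) := fun σ =>
    {φ | φ.Holds C (fun s => Sum.elim (fun a => a.1) fun a => σ.1 s a.1)}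
  let E : Set (Set (Formula L (fun s => M.carrier s ⊕ M.carrier s) [])) →
      Set (TypeSpace C X → TypeSpace C X) := fun B => (fun σ y => σ • y) '' (tp ⁻¹' B)
  have htp : ∀ σ τ, tp σ = tp τ → ∀ p ∈ lascarInvariant X κ, σ • p = τ • p := fun σ τ h p hp =>
    smul_eq_smul_of_holds_iff hC hM (hs.trans_lt hC.card_lt) (fun φ => Set.ext_iff.1 h φ) hp
  -- The code of `f` is the family of those sets `B` of types over `M` for which `f` is a limit of
  -- automorphisms with type in `B`.
  refine ⟨Set (Set (Set (Formula L (fun s => M.carrier s ⊕ M.carrier s) []))),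
    fun f => {B | f ∈ closure (E B)}, ?_, ?_⟩
  · simp only [mk_set]
    have : #(Formula L (fun s => M.carrier s ⊕ M.carrier s) []) ≤ L.card := by
      refine mk_formula_le le_rfl ?_ _
      rw [mk_congr (Equiv.sigmaSumDistrib _ _), ← add_def]
      exact add_le_of_le L.aleph0_le_card hs hs
    have h2 := two_ne_zero (α := Cardinal.{u})
    exact power_le_power_left h2 (power_le_power_left h2 (power_le_power_left h2 this))
  · intro f hf g hfg p hp
    refine ext_of_subset fun φ hφ => ?_
    by_contra h
    rw [← GlobalType.not_mem_iff] at h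
    -- `B` collects the types of all `σ` with `φ ∈ σ • p`. It belongs to the code of `f`, hence to
    -- that of `g`; but near `g` there are automorphisms putting `φ.not` into the image of `p`,
    -- against `htp`.
    have hB : tp '' {σ | φ ∈ (σ • p).1.formulas} ∈ {B | f ∈ closure (E B)} := by
      refine mem_closure_iff.2 fun o ho hfo => ?_
      obtain ⟨_, ⟨h₁, h₂⟩, τ, rfl⟩ := mem_closure_iff.1 hf _
        (ho.inter (isOpen_setOf_apply_mem φ p)) ⟨hfo, hφ⟩
      exact ⟨_, h₁, τ, ⟨τ, h₂, rfl⟩, rfl⟩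
    replace hB : g ∈ closure (E _) := (Set.ext_iff.1 hfg _).1 hB
    obtain ⟨_, h₁, σ, ⟨τ, h₂, h₃⟩, rfl⟩ := mem_closure_iff.1 hB _
      (isOpen_setOf_apply_mem φ.not p) h
    have h₄ : φ.not ∈ (σ • p).1.formulas := h₁
    rw [← htp τ σ h₃ p hp] at h₄
    exact (GlobalType.not_mem_iff _ _).1 h₄ h₂

/-- If a minimal left ideal contains a function with Lascar invariant values, then its size is at
most `ℶ₃(|T|)`. -/
theorem mk_minimalLeftIdeal_le (hC : IsMonster C κ)
    {M : Set (TypeSpace C X → TypeSpace C X)}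
    (hM : IsMinimalLeftIdeal (ellisSemigroup (Aut C) (TypeSpace C X)) M)
    {μ : TypeSpace C X → TypeSpace C X} (hμM : μ ∈ M) (hμ : Set.range μ ⊆ lascarInvariant X κ) :
    #M ≤ (2 : Cardinal.{u}) ^ ((2 : Cardinal.{u}) ^ ((2 : Cardinal.{u}) ^ L.card)) := by
  obtain ⟨Z, D, hZ, hD⟩ := exists_code_ellisSemigroup (X := X) hC
  choose θ hθ hθμ using fun η : M => hM.exists_comp_eq
    (fun _ hf _ hg => comp_mem_ellisSemigroup hf hg) hμM η.2
  refine (mk_le_of_injective (f := fun η => D (θ η)) fun η η' h => ?_).trans hZ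
  refine Subtype.ext ?_
  rw [← hθμ η, ← hθμ η']
  funext p
  exact hD _ (hθ η) _ h _ (hμ ⟨p, rfl⟩)

/-- The elements of a left ideal of bounded size have Lascar invariant values. -/
theorem range_subset_lascarInvariant_of_mk_lt (hC : IsMonster C κ)
    {M : Set (TypeSpace C X → TypeSpace C X)}
    (hM : IsLeftIdeal (ellisSemigroup (Aut C) (TypeSpace C X)) M) (hMκ : #M < κ)
    {η : TypeSpace C X → TypeSpace C X} (hη : η ∈ M) : Set.range η ⊆ lascarInvariant X κ := by
  rintro _ ⟨p, rfl⟩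
  rw [mem_lascarInvariant_iff]
  intro N ρ hN hs hρ
  refine ext_of_subset fun φ hφ => ?_
  obtain ⟨Γ, a, ψ, rfl⟩ := φ.exists_map_env_eq
  -- Recording all `f ∈ M`, and not `η` alone, makes the equivalence invariant: moving `x` by `σ`
  -- amounts to replacing `f` by `σ⁻¹ ∘ f`, again in `M`.
  let F : (∀ s, BVar Γ s → C.carrier s) → Set M := fun x =>
    {f | ψ.map (fun s => Sum.map id (x s)) ∈ (f.1 p).1.formulas}
  have happ : ∀ (σ : Aut C) (x : ∀ s, BVar Γ s → C.carrier s),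
      GlobalFormula.applyAut σ (ψ.map fun s => Sum.map id (x s)) =
        ψ.map fun s => Sum.map id fun i => σ.1 s (x s i) := by
    intro σ x
    unfold GlobalFormula.applyAut
    rw [Formula.map_map]
    congr 1
    funext s y
    cases y <;> rfl
  have hF : ∀ (σ : Aut C) x y, F x = F y →
      F (fun s i => σ.1 s (x s i)) = F fun s i => σ.1 s (y s i) := by
    intro σ x y h
    ext f
    let g : M := ⟨(fun q => σ⁻¹ • q) ∘ f.1, hM.2.2 _ (smul_mem_ellisSemigroup _) _ f.2⟩
    have hg : ∀ z, f ∈ F (fun s i => σ.1 s (z s i)) ↔ g ∈ F z := by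
      intro z
      change _ ↔ GlobalFormula.applyAut σ⁻¹⁻¹ (ψ.map fun s => Sum.map id (z s)) ∈ (f.1 p).1.formulas
      rw [inv_inv, happ]
      rfl
    rw [hg, hg, h]
  have hN' : ∀ s, ∀ b ∈ N.carrier s, (ρ⁻¹).1 s b = b := by
    intro s b hb
    change (ρ.1 s).symm b = b
    rw [Equiv.symm_apply_eq, hρ s b hb]
  have key := hC.eq_of_bounded_invariant (Z := Set M)
    (by rw [mk_set]; exact hC.strongLimit.isStrongPrelimit hMκ) F hF hN hs a
    (fun s i => (ρ⁻¹).1 s (a s i)) fun χ => by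
      rw [← Formula.realize_aut ρ⁻¹]
      refine iff_of_eq (congrArg (fun w => Formula.Realize C w χ _) ?_)
      funext s b
      exact hN' s b.1 b.2
  have h : GlobalFormula.applyAut ρ⁻¹ (ψ.map fun s => Sum.map id (a s)) ∈ (η p).1.formulas := hφ
  rw [happ] at h
  have h' : (⟨η, hη⟩ : M) ∈ F a := by
    rw [key]
    exact h
  exact h'

end TypeSpace

end ManySorted

/-! ### The equivalence and the bound -/

theorem proposition5p4 (L : ManySorted.Language.{u}) (T : Set (ManySorted.Sentence L))
    (C : ManySorted.Struct L) (κ : Cardinal.{u})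
    (hT : C.IsModel T) (hC : ManySorted.IsMonster C κ)
    (I : L.Srt → Type u) (X : Set (ManySorted.Formula L I []))
    (M : Set (ManySorted.TypeSpace C X → ManySorted.TypeSpace C X))
    (hM : ManySorted.IsMinimalLeftIdeal
      (ManySorted.ellisSemigroup (ManySorted.Aut C) (ManySorted.TypeSpace C X)) M) :
    List.TFAE [
      Cardinal.mk M < κ,
      ∀ η ∈ M, Set.range η ⊆ ManySorted.TypeSpace.lascarInvariant X κ,
      ∃ η ∈ ManySorted.ellisSemigroup (ManySorted.Aut C) (ManySorted.TypeSpace C X),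
        Set.range η ⊆ ManySorted.TypeSpace.lascarInvariant X κ] ∧
    (Cardinal.mk M < κ →
      Cardinal.mk M ≤ (2 : Cardinal.{u}) ^ ((2 : Cardinal.{u}) ^ ((2 : Cardinal.{u}) ^ L.card))) := by
  have hlt : ∀ {c : Cardinal.{u}}, c < κ → (2 : Cardinal.{u}) ^ c < κ :=
    fun h => hC.strongLimit.isStrongPrelimit h
  have h₁₂ : Cardinal.mk M < κ →
      ∀ η ∈ M, Set.range η ⊆ ManySorted.TypeSpace.lascarInvariant X κ := fun h _ hη =>
    ManySorted.TypeSpace.range_subset_lascarInvariant_of_mk_lt hC hM.1 h hη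
  have h₂ : (∀ η ∈ M, Set.range η ⊆ ManySorted.TypeSpace.lascarInvariant X κ) →
      Cardinal.mk M ≤
        (2 : Cardinal.{u}) ^ ((2 : Cardinal.{u}) ^ ((2 : Cardinal.{u}) ^ L.card)) := fun h =>
    have ⟨_, hμ⟩ := hM.1.2.1
    ManySorted.TypeSpace.mk_minimalLeftIdeal_le hC hM hμ (h _ hμ)
  refine ⟨?_, fun h => h₂ (h₁₂ h)⟩
  tfae_have 1 → 2 := h₁₂
  tfae_have 2 → 1 := fun h => (h₂ h).trans_lt (hlt (hlt (hlt hC.card_lt)))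
  tfae_have 2 → 3 := fun h =>
    have ⟨μ, hμ⟩ := hM.1.2.1
    ⟨μ, hM.1.1 hμ, h μ hμ⟩
  -- `ν ∘ η` lies in `M` and therefore generates it, so `η = θ ∘ ν ∘ η` for some `θ`.
  tfae_have 3 → 2 := by
    rintro ⟨ν, hν, hνI⟩ η hη
    obtain ⟨θ, hθ, hθη⟩ := hM.exists_comp_eq
      (fun _ hf _ hg => ManySorted.comp_mem_ellisSemigroup hf hg) (hM.1.2.2 ν hν η hη) hη
    rintro _ ⟨p, rfl⟩
    rw [← hθη]
    exact ManySorted.TypeSpace.apply_mem_lascarInvariant hθ (hνI ⟨η p, rfl⟩)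
  tfae_finish
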